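/- Let $N\ge 1$ be an integer and $\hbar,g,\kappa>0$, and put $\rho=\kappa g^{2N}$. Let $\delta_1,\dots,\delta_N\in\mathbb C$ be a family that is invariant under complex conjugation, with $|\mathrm{Im}\,\delta_k|<\hbar/2$, and put $\vartheta(\lambda)=\prod_{k=1}^N(\lambda-\delta_k)$. Let $Y_\delta:\mathbb R\to(0,\infty)$, with $\ln Y_\delta$ continuous, non-negative and bounded, be the solution of the nonlinear integral equation $$\ln Y_\delta(\lambda)=\int_{\mathbb R}\frac{\hbar}{\pi((\lambda-\mu)^2+\hbar^2)}\,\ln V_\delta(\mu)\,d\mu,\qquad V_\delta(\mu)=1+\frac{\rho^\hbar Y_\delta(\mu)}{|\vartheta(\mu-i\hbar/2)|^2}.$$ Let $v_\uparrow(\lambda)=\exp\Big(-\int_{\mathbb R}\frac{d\mu}{2i\pi}\frac{\ln V_\delta(\mu)}{\lambda-\mu+i\hbar/2}\Big)$ for $\mathrm{Im}\,\lambda>-\hbar/2$ and $v_\downarrow(\lambda-i\hbar)=\exp\Big(\int_{\mathbb R}\frac{d\mu}{2i\pi}\frac{\ln V_\delta(\mu)}{\lambda-\mu-i\hbar/2}\Big)$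 for $\mathrm{Im}\,\lambda<\hbar/2$, and let $Q^\pm_\delta$ be the entire functions that continue $$Q_\delta^+(\lambda)=\frac{(\kappa g^N)^{-i\lambda}\,\hbar^{iN\lambda/\hbar}\,e^{-N\pi\lambda/\hbar}\,v_\uparrow(\lambda)}{\prod_{k=1}^N\Gamma(1-i(\lambda-\delta_k)/\hbar)},\qquad Q_\delta^-(\lambda)=\frac{g^{iN\lambda}\,\hbar^{-iN\lambda/\hbar}\,e^{-N\pi\lambda/\hbar}\,v_\downarrow(\lambda-i\hbar)}{\prod_{k=1}^N\Gamma(1+i(\lambda-\delta_k)/\hbar)}$$ from these half-planes. Put $$t_\delta(\lambda)=(-i)^N(\kappa g^N)^\hbar\;\frac{Q_\delta^+(\lambda-i\hbar)Q_\delta^-(\lambda+i\hbar)-Q_\delta^+(\lambda+i\hbar)Q_\delta^-(\lambda-i\hbar)}{Q_\delta^+(\lambda)Q_\delta^-(\lambda+i\hbar)-Q_\delta^+(\lambda+i\hbar)Q_\delta^-(\lambda)}.$$ Assume that $t_\delta(\lambda)=\prod_{a=1}^N(\lambda-\tau_a)$ with $|\mathrm{Im}\,\tau_a|<\hbar/2$,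 and that $\delta_1,\dots,\delta_N$ are the zeros, in the strip $|\mathrm{Im}\,z|<\hbar/2$, of the Hill determinant $\mathcal H$ associated with $t_\delta$. Here $\mathcal H(\lambda)$ is the limit, as $M\to\infty$, of the determinants of the truncations to the indices $-M\le m,n\le M$ of the tridiagonal matrix whose row $n\in\mathbb Z$ has diagonal entry $1$, entry $\rho^\hbar/t_\delta(\lambda+in\hbar)$ to the left of the diagonal and entry $1/t_\delta(\lambda+in\hbar)$ to its right; zeros are counted with multiplicity and before cancellation against the poles $\tau_a$, i.e. at each point of the strip the order of $\mathcal H$ is the number of $\delta$'s minus the number of $\tau$'s equal to that point. Then for every integer $k$ with $1\le k\le 2N-1$ the integral below converges absolutely, and $$\sum_{p=1}^N\tau_p^k=\sum_{p=1}^N\delta_p^k+k\int_{\mathbb R}\frac{d\mu}{2i\pi}\Big\{(\mu+i\tfrac\hbar2)^{k-1}-(\mu-i\tfrac\hbar2)^{k-1}\Big\}\ln\Big(1+\frac{\rho^\hbar\,Y_\delta(\mu)}{|\vartheta(\mu-i\hbar/2)|^2}\Big).$$ -/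

import Mathlib

open Complex MeasureTheory Filter Topology

noncomputable section

namespace TodaTBA

/-- The monic polynomial function `z ↦ ∏ₖ (z - rₖ)` with the family of roots `r`. It is used for
`ϑ` (roots `δₖ`) and for the transfer matrix eigenvalue `t` (roots `τₖ`). -/
def monic {N : ℕ} (r : Fin N → ℂ) (z : ℂ) : ℂ := ∏ k, (z - r k)

/-- The family `r` is invariant under complex conjugation, counting multiplicities. -/
def SelfConj {N : ℕ} (r : Fin N → ℂ) : Prop :=
  ∃ σ : Equiv.Perm (Fin N), ∀ k, (starRingEnd ℂ) (r k) = r (σ k)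

/-! ### The Hill determinant -/

/-- The doubly infinite tridiagonal matrix with rows indexed by `n ∈ ℤ`; the row `n` is
`…, 0, ρ^ℏ / t(z + i n ℏ), 1, 1 / t(z + i n ℏ), 0, …` with the entry `1` on the diagonal. -/
def hillMatrix (hbar ρ : ℝ) {N : ℕ} (τ : Fin N → ℂ) (z : ℂ) : Matrix ℤ ℤ ℂ :=
  Matrix.of fun m n =>
    if n = m then 1
    else if n = m + 1 then 1 / monic τ (z + I * m * hbar)
    else if n = m - 1 then ((ρ ^ hbar : ℝ) : ℂ) / monic τ (z + I * m * hbar)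
    else 0

/-- The Hill determinant: the limit, as `M → ∞`, of the determinants of the truncations of the
infinite matrix to the indices `-M ≤ m, n ≤ M`. -/
def hillDet (hbar ρ : ℝ) {N : ℕ} (τ : Fin N → ℂ) (z : ℂ) : ℂ :=
  limUnder atTop fun M : ℕ =>
    ((hillMatrix hbar ρ τ z).submatrix
      (fun i : Finset.Icc (-(M : ℤ)) (M : ℤ) => (i : ℤ))
      (fun i : Finset.Icc (-(M : ℤ)) (M : ℤ) => (i : ℤ))).det

/-- `δ` is the family of the `N` zeros, with multiplicities, of the Hill determinant built from
`t = ∏ (z - τₖ)`, in the strip `|Im z| < ℏ / 2`.  In that strip the poles of the Hill determinant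
are the `τₖ`; a zero sitting on a pole `τₖ` is counted before cancellation, so that at each point
the order of the Hill determinant is the number of `δ`'s minus the number of `τ`'s there. -/
def IsHillZeros (hbar ρ : ℝ) {N : ℕ} (τ δ : Fin N → ℂ) : Prop :=
  (∀ k, |(δ k).im| < hbar / 2) ∧
  ∀ z : ℂ, |z.im| < hbar / 2 →
    meromorphicOrderAt (hillDet hbar ρ τ) z =
      ((({a | δ a = z} : Set (Fin N)).ncard : ℤ) - (({a | τ a = z} : Set (Fin N)).ncard : ℤ) : ℤ)

/-! ### The nonlinear integral equation -/

/-- `K(x) = ℏ / (π (x² + ℏ²))`. -/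
def kernel (hbar x : ℝ) : ℝ := hbar / (Real.pi * (x ^ 2 + hbar ^ 2))

/-- `V(μ) = 1 + ρ^ℏ Y(μ) / |ϑ(μ - iℏ/2)|²`, where `ϑ = ∏ (z - δₖ)`. -/
def V (hbar ρ : ℝ) {N : ℕ} (δ : Fin N → ℂ) (Y : ℝ → ℝ) (μ : ℝ) : ℝ :=
  1 + ρ ^ hbar * Y μ / ‖monic δ ((μ : ℂ) - I * hbar / 2)‖ ^ 2

/-- `Y` solves the nonlinear integral equation on the real line, in the class of functions for
which `log Y` is continuous, nonnegative and bounded. -/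
structure IsNLIESolution (hbar ρ : ℝ) {N : ℕ} (δ : Fin N → ℂ) (Y : ℝ → ℝ) : Prop where
  pos : ∀ x, 0 < Y x
  continuous_log : Continuous fun x => Real.log (Y x)
  log_nonneg : ∀ x, 0 ≤ Real.log (Y x)
  log_bounded : ∃ C : ℝ, ∀ x, Real.log (Y x) ≤ C
  equation : ∀ x, Real.log (Y x) = ∫ μ : ℝ, kernel hbar (x - μ) * Real.log (V hbar ρ δ Y μ)

/-! ### The functions `v`, `Q` and `t` constructed from a solution `Y` -/

/-- `v_↑(z)`, given by its integral representation, valid for `Im z > -ℏ/2`. -/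
def vUp (hbar ρ : ℝ) {N : ℕ} (δ : Fin N → ℂ) (Y : ℝ → ℝ) (z : ℂ) : ℂ :=
  exp (-∫ μ : ℝ, 1 / (2 * Real.pi * I) * (1 / (z - μ + I * hbar / 2)) *
    (Real.log (V hbar ρ δ Y μ) : ℂ))

/-- `v_↓(z - iℏ)`, given by its integral representation, valid for `Im z < ℏ/2`. -/
def vDownShift (hbar ρ : ℝ) {N : ℕ} (δ : Fin N → ℂ) (Y : ℝ → ℝ) (z : ℂ) : ℂ :=
  exp (∫ μ : ℝ, 1 / (2 * Real.pi * I) * (1 / (z - μ - I * hbar / 2)) *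
    (Real.log (V hbar ρ δ Y μ) : ℂ))

open Classical in
/-- The continuation to an entire function of a function `f` given on the set `U` (it is unique as
soon as `U` is open and nonempty); if there is none, the value is `f` itself. -/
def entireContinuation (U : Set ℂ) (f : ℂ → ℂ) : ℂ → ℂ :=
  if h : ∃ F : ℂ → ℂ, Differentiable ℂ F ∧ Set.EqOn F f U then h.choose else f

/-- The entire function `Q_δ⁺`, continued from the half-plane `Im z > -ℏ/2`, where
`Q_δ⁺(z) = (κ g^N)^{-iz} ℏ^{iNz/ℏ} e^{-Nπz/ℏ} v_↑(z) / ∏ₖ Γ(1 - i(z - δₖ)/ℏ)`. -/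
def QPlus (hbar g κ : ℝ) {N : ℕ} (δ : Fin N → ℂ) (Y : ℝ → ℝ) : ℂ → ℂ :=
  entireContinuation {z | -(hbar / 2) < z.im} fun z =>
    ((κ * g ^ N : ℝ) : ℂ) ^ (-I * z) * (hbar : ℂ) ^ (I * N * z / hbar) *
      exp (-(N * Real.pi * z / hbar)) * vUp hbar (κ * g ^ (2 * N)) δ Y z /
        ∏ k, Gamma (1 - I * (z - δ k) / hbar)

/-- The entire function `Q_δ⁻`, continued from the half-plane `Im z < ℏ/2`, where
`Q_δ⁻(z) = g^{iNz} ℏ^{-iNz/ℏ} e^{-Nπz/ℏ} v_↓(z - iℏ) / ∏ₖ Γ(1 + i(z - δₖ)/ℏ)`. -/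
def QMinus (hbar g κ : ℝ) {N : ℕ} (δ : Fin N → ℂ) (Y : ℝ → ℝ) : ℂ → ℂ :=
  entireContinuation {z | z.im < hbar / 2} fun z =>
    (g : ℂ) ^ (I * N * z) * (hbar : ℂ) ^ (-(I * N * z / hbar)) *
      exp (-(N * Real.pi * z / hbar)) * vDownShift hbar (κ * g ^ (2 * N)) δ Y z /
        ∏ k, Gamma (1 + I * (z - δ k) / hbar)

/-- The quantum Wronskian `Q_δ⁺(z) Q_δ⁻(z + iℏ) - Q_δ⁺(z + iℏ) Q_δ⁻(z)`. -/
def wronskian (hbar g κ : ℝ) {N : ℕ} (δ : Fin N → ℂ) (Y : ℝ → ℝ) (z : ℂ) : ℂ :=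
  QPlus hbar g κ δ Y z * QMinus hbar g κ δ Y (z + I * hbar) -
    QPlus hbar g κ δ Y (z + I * hbar) * QMinus hbar g κ δ Y z

/-- The function `t_δ`, given by the quotient below where the quantum Wronskian does not vanish. -/
def tDelta (hbar g κ : ℝ) {N : ℕ} (δ : Fin N → ℂ) (Y : ℝ → ℝ) (z : ℂ) : ℂ :=
  (-I) ^ N * (((κ * g ^ N) ^ hbar : ℝ) : ℂ) *
    (QPlus hbar g κ δ Y (z - I * hbar) * QMinus hbar g κ δ Y (z + I * hbar) -
      QPlus hbar g κ δ Y (z + I * hbar) * QMinus hbar g κ δ Y (z - I * hbar)) /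
    wronskian hbar g κ δ Y z

/-- `t_δ` is the polynomial `∏ₐ (z - τₐ)`, i.e. the `τₐ` are the zeros of `t_δ`. -/
def IsZerosOfTDelta (hbar g κ : ℝ) {N : ℕ} (δ τ : Fin N → ℂ) (Y : ℝ → ℝ) : Prop :=
  ∀ z : ℂ, wronskian hbar g κ δ Y z ≠ 0 → tDelta hbar g κ δ Y z = monic τ z

end TodaTBA

end

/-!
The integral equation expresses `log Y` as the jump of the Cauchy transform `T` of `log V`, and
`v_↑ = exp (-T(· + iℏ/2))`, `v_↓(· - iℏ) = exp (T(· - iℏ/2))`. Hence `V`, which is an explicit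
function of `Y`, extends holomorphically across the real line, `T` jumps there by `log V`, and
`Q⁺` continues across the line `Im z = -ℏ/2` by a first-order difference equation that involves
`Q⁻`. This difference equation is a formula for the quantum Wronskian, which turns out to be
`ϑ` times elementary factors. Eliminating the outer shifts from the definition of `t` by means of
the Wronskians at `z` and `z - iℏ` gives, on the real line,
`t v_↑ v_↓ = ϑ + ρ^ℏ (v_↑(x + iℏ) v_↓(x) / ϑ(x + iℏ) + v_↑(x) v_↓(x - iℏ) / ϑ(x - iℏ))`, so that
`t v_↑ v_↓ / ϑ = 1 + O(x^{-2N})`. Taking logarithms and comparing the coefficients of `x^{-k}` for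
`k < 2N` yields the sum rules: `log t` and `log ϑ` contribute the power sums of `τ` and `δ`, and
`T(x ± iℏ/2)` the moments of `log V` about `∓iℏ/2`.
-/

noncomputable section

namespace TodaTBA

open Asymptotics

/-! ### Holomorphic dependence of integrals on a parameter -/

section ParametricIntegral

variable {α E : Type*} [MeasurableSpace α] {ν : Measure α} [NormedAddCommGroup E]

theorem aestronglyMeasurable_deriv_of_ae_differentiableAt {𝕜 : Type*} [NontriviallyNormedField 𝕜]
    [NormedSpace 𝕜 E] {F : 𝕜 → α → E} {w₀ : 𝕜}
    (hm : ∀ᶠ w in 𝓝 w₀, AEStronglyMeasurable (F w) ν)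
    (hd : ∀ᵐ s ∂ν, DifferentiableAt 𝕜 (fun w => F w s) w₀) :
    AEStronglyMeasurable (fun s => deriv (fun w => F w s) w₀) ν := by
  obtain ⟨w, hw, hwm⟩ := exists_seq_forall_of_frequently
    (hm.filter_mono nhdsWithin_le_nhds : ∀ᶠ w in 𝓝[≠] w₀, AEStronglyMeasurable (F w) ν).frequently
  refine aestronglyMeasurable_of_tendsto_ae atTop
    (f := fun n s => (w n - w₀)⁻¹ • (F (w n) s - F w₀ s))
    (fun n => ((hwm n).sub hm.self_of_nhds).const_smul _) ?_
  filter_upwards [hd] with s hs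
  exact (hasDerivAt_iff_tendsto_slope.1 hs.hasDerivAt).comp hw

theorem differentiableOn_integral_of_dominated [NormedSpace ℂ E] {U : Set ℂ} (hU : IsOpen U)
    {F : ℂ → α → E} {B : α → ℝ} (hB : Integrable B ν)
    (hm : ∀ w ∈ U, AEStronglyMeasurable (F w) ν)
    (hd : ∀ᵐ s ∂ν, DifferentiableOn ℂ (fun w => F w s) U)
    (hb : ∀ᵐ s ∂ν, ∀ w ∈ U, ‖F w s‖ ≤ B s) :
    DifferentiableOn ℂ (fun w => ∫ s, F w s ∂ν) U := by
  intro w₀ hw₀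
  obtain ⟨ε, hε, hball⟩ := Metric.nhds_basis_closedBall.mem_iff.1 (hU.mem_nhds hw₀)
  have hsub : ∀ w ∈ Metric.ball w₀ (ε / 2), Metric.closedBall w (ε / 2) ⊆ U := fun w hw =>
    (Metric.closedBall_subset_closedBall' (by linarith [Metric.mem_ball.1 hw])).trans hball
  have hdiff : ∀ᵐ s ∂ν, ∀ w ∈ U, DifferentiableAt ℂ (fun w => F w s) w := by
    filter_upwards [hd] with s hs w hw using (hs w hw).differentiableAt (hU.mem_nhds hw)
  have hmem : ∀ w ∈ Metric.ball w₀ (ε / 2), w ∈ U := fun w hw =>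
    hsub w hw (Metric.mem_closedBall_self (half_pos hε).le)
  have hasDeriv := hasDerivAt_integral_of_dominated_loc_of_deriv_le
    (F' := fun w s => deriv (fun w => F w s) w) (bound := fun s => B s / (ε / 2))
    (Metric.ball_mem_nhds w₀ (half_pos hε))
    (eventually_of_mem (hU.mem_nhds hw₀) hm)
    (hB.mono' (hm _ hw₀) (hb.mono fun s hs => hs _ hw₀))
    (aestronglyMeasurable_deriv_of_ae_differentiableAt (eventually_of_mem (hU.mem_nhds hw₀) hm)
      (hdiff.mono fun s hs => hs w₀ hw₀))
    ?_ (hB.div_const _)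
    (hdiff.mono fun s hs w hw => (hs w (hmem w hw)).hasDerivAt)
  · exact hasDeriv.2.differentiableAt.differentiableWithinAt
  · filter_upwards [hd, hb] with s hs hbs w hw
    exact norm_deriv_le_of_forall_mem_sphere_norm_le (half_pos hε)
      ((hs.mono (hsub w hw)).diffContOnCl_ball subset_rfl)
      fun z hz => hbs z (hsub w hw (Metric.sphere_subset_closedBall hz))

end ParametricIntegral

section DividedDifference

theorem dslope_comm {𝕜 E : Type*} [NontriviallyNormedField 𝕜] [NormedAddCommGroup E]
    [NormedSpace 𝕜 E] (g : 𝕜 → E) (a b : 𝕜) : dslope g a b = dslope g b a := by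
  rcases eq_or_ne a b with rfl | h
  · rfl
  · rw [dslope_of_ne _ h.symm, dslope_of_ne _ h, slope_comm]

theorem norm_dslope_le_of_norm_deriv_le {𝕜 E : Type*} [RCLike 𝕜] [NormedAddCommGroup E]
    [NormedSpace 𝕜 E] {g : 𝕜 → E} {s : Set 𝕜} (hs : Convex ℝ s)
    (hg : ∀ z ∈ s, DifferentiableAt 𝕜 g z) {C : ℝ} (hC : ∀ z ∈ s, ‖deriv g z‖ ≤ C) {z w : 𝕜}
    (hz : z ∈ s) (hw : w ∈ s) : ‖dslope g z w‖ ≤ C := by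
  rcases eq_or_ne w z with rfl | h
  · rw [dslope_same]
    exact hC _ hw
  · rw [dslope_of_ne _ h, slope, vsub_eq_sub, norm_smul, norm_inv, inv_mul_eq_div,
      div_le_iff₀ (norm_pos_iff.2 (sub_ne_zero.2 h))]
    exact hs.norm_image_sub_le_of_norm_deriv_le hg hC hz hw

theorem differentiableOn_integral_dslope {U : Set ℂ} (hU : IsOpen U) (hUc : Convex ℝ U)
    {g : ℂ → ℂ} (hg : DifferentiableOn ℂ g U) {C : ℝ} (hC : ∀ z ∈ U, ‖deriv g z‖ ≤ C)
    {a b : ℝ} (hab : ∀ μ ∈ Set.uIcc a b, (μ : ℂ) ∈ U) :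
    DifferentiableOn ℂ (fun w => ∫ μ in a..b, dslope g (μ : ℂ) w) U := by
  have hslope : ∀ z ∈ U, DifferentiableOn ℂ (dslope g z) U := fun z hz =>
    (differentiableOn_dslope (hU.mem_nhds hz)).2 hg
  have hmem : ∀ μ ∈ Set.uIoc a b, (μ : ℂ) ∈ U := fun μ hμ => hab μ (Set.uIoc_subset_uIcc hμ)
  simp_rw [intervalIntegral.intervalIntegral_eq_integral_uIoc]
  refine DifferentiableOn.const_smul (differentiableOn_integral_of_dominated hU
    (B := fun _ => C) (integrableOn_const (by simp [Set.uIoc])) ?_ ?_ ?_) _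
  · intro w hw
    simp_rw [fun μ : ℝ => dslope_comm g μ w]
    exact ((hslope w hw).continuousOn.comp continuous_ofReal.continuousOn
      hmem).aestronglyMeasurable measurableSet_uIoc
  · filter_upwards [ae_restrict_mem measurableSet_uIoc] with μ hμ using hslope μ (hmem μ hμ)
  · filter_upwards [ae_restrict_mem measurableSet_uIoc] with μ hμ w hw
    exact norm_dslope_le_of_norm_deriv_le hUc
      (fun z hz => hg.differentiableAt (hU.mem_nhds hz)) hC (hmem μ hμ) hw

end DividedDifference

/-! ### The Cauchy transform of a function on the real line -/

/-- The Cauchy transform `w ↦ ∫ f(μ) / (2πi (w - μ)) dμ` of a function on the real line; the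
exponents of `v_↑` and `v_↓` are, up to sign, shifts of the Cauchy transform of `log V`. -/
def cauchyTransform (f : ℝ → ℂ) (w : ℂ) : ℂ :=
  ∫ μ : ℝ, 1 / (2 * Real.pi * I) * (1 / (w - μ)) * f μ

theorem norm_one_div_two_pi_I : ‖(1 / (2 * Real.pi * I) : ℂ)‖ = 1 / (2 * Real.pi) := by
  simp [abs_of_pos Real.pi_pos]

theorem abs_im_le_norm_sub_ofReal (w : ℂ) (μ : ℝ) : |w.im| ≤ ‖w - μ‖ := by
  simpa using abs_im_le_norm (w - μ)

theorem sub_ofReal_ne_zero {w : ℂ} (hw : w.im ≠ 0) (μ : ℝ) : w - μ ≠ 0 := fun h =>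
  hw (by simpa using congrArg im h)

section CauchyTransform

variable {f : ℝ → ℂ} {ν : Measure ℝ} {w : ℂ} {ε : ℝ}

theorem norm_cauchy_integrand_le (hε : 0 < ε) {μ : ℝ} (hw : ε ≤ ‖w - μ‖) :
    ‖1 / (2 * Real.pi * I) * (1 / (w - μ)) * f μ‖ ≤
      1 / (2 * Real.pi) * (1 / ε) * ‖f μ‖ := by
  rw [norm_mul, norm_mul, norm_one_div_two_pi_I, norm_div, norm_one]
  gcongr

theorem aestronglyMeasurable_cauchy_integrand (hf : AEStronglyMeasurable f ν) (w : ℂ) :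
    AEStronglyMeasurable (fun μ : ℝ => 1 / (2 * Real.pi * I) * (1 / (w - μ)) * f μ) ν :=
  (Measurable.aestronglyMeasurable (by fun_prop)).mul hf

theorem differentiableOn_integral_cauchy (hf : Integrable f ν) {U : Set ℂ} (hU : IsOpen U)
    (hε : 0 < ε) (hd : ∀ᵐ μ : ℝ ∂ν, ∀ w ∈ U, ε ≤ ‖w - μ‖) :
    DifferentiableOn ℂ (fun w => ∫ μ : ℝ, 1 / (2 * Real.pi * I) * (1 / (w - μ)) * f μ ∂ν) U := by
  refine differentiableOn_integral_of_dominated hU (hf.norm.const_mul _)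
    (fun w _ => aestronglyMeasurable_cauchy_integrand hf.aestronglyMeasurable w) ?_
    (hd.mono fun μ hμ w hw => norm_cauchy_integrand_le hε (hμ w hw))
  filter_upwards [hd] with μ hμ w hw
  have : w - μ ≠ 0 := norm_pos_iff.1 (hε.trans_le (hμ w hw))
  refine DifferentiableAt.differentiableWithinAt ?_
  fun_prop (disch := assumption)

theorem analyticAt_cauchyTransform (hf : Integrable f) (hw : w.im ≠ 0) :
    AnalyticAt ℂ (cauchyTransform f) w := by
  have hw' : 0 < |w.im| := abs_pos.2 hw
  have ho : IsOpen {z : ℂ | |w.im| / 2 < |z.im|} :=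
    isOpen_lt continuous_const (continuous_abs.comp continuous_im)
  exact (differentiableOn_integral_cauchy hf ho (half_pos hw') (Eventually.of_forall fun μ z hz =>
    (hz.le.trans (abs_im_le_norm_sub_ofReal z μ)))).analyticAt
    (ho.mem_nhds (half_lt_self hw'))

theorem integrable_cauchy_integrand (hf : Integrable f) (hw : w.im ≠ 0) :
    Integrable fun μ : ℝ => 1 / (2 * Real.pi * I) * (1 / (w - μ)) * f μ :=
  (hf.norm.const_mul _).mono' (aestronglyMeasurable_cauchy_integrand hf.aestronglyMeasurable w)
    (Eventually.of_forall fun μ =>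
      norm_cauchy_integrand_le (abs_pos.2 hw) (abs_im_le_norm_sub_ofReal w μ))

end CauchyTransform

/-! ### Continuation of the Cauchy transform across the real line -/

theorem log_neg_of_im_pos {u : ℂ} (hu : 0 < u.im) : log (-u) = log u - Real.pi * I := by
  rw [log, log, norm_neg, arg_neg_eq_arg_sub_pi_of_im_pos hu]
  push_cast
  ring

theorem integral_one_div_sub {w : ℂ} (hw : w.im ≠ 0) (a b : ℝ) :
    ∫ μ in a..b, 1 / (w - μ) = log (w - a) - log (w - b) := by
  have hs : ∀ μ : ℝ, w - μ ∈ slitPlane := fun μ => mem_slitPlane_iff.2 (Or.inr (by simpa using hw))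
  have hd : ∀ μ : ℝ, HasDerivAt (fun μ : ℝ => -log (w - μ)) (1 / (w - μ)) μ := fun μ => by
    have h := (((hasDerivAt_id (μ : ℂ)).const_sub w).clog (hs μ)).fun_neg
    rw [neg_div, neg_neg] at h
    exact h.comp_ofReal
  rw [intervalIntegral.integral_eq_sub_of_hasDerivAt (fun μ _ => hd μ)]
  · ring
  · exact (continuous_const.div (by fun_prop) fun μ =>
      slitPlane_ne_zero (hs μ)).intervalIntegrable _ _

/-- The integrand is `(g w - g μ) / (w - μ)`, so that the singularity of the Cauchy kernel is
carried by the explicit term alone. -/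
theorem integral_dslope_eq {f : ℝ → ℂ} (hf : Integrable f) {g : ℂ → ℂ} {a b : ℝ}
    (hfg : ∀ μ ∈ Set.uIoc a b, g μ = f μ) {w : ℂ} (hw : w.im ≠ 0) :
    ∫ μ in a..b, dslope g (μ : ℂ) w =
      g w * (log (w - a) - log (w - b)) - ∫ μ in a..b, 1 / (w - μ) * f μ := by
  have hcont : Continuous fun μ : ℝ => 1 / (w - μ) :=
    continuous_const.div (by fun_prop) (sub_ofReal_ne_zero hw)
  rw [← integral_one_div_sub hw, ← intervalIntegral.integral_const_mul,
    ← intervalIntegral.integral_sub ((hcont.intervalIntegrable a b).const_mul _)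
      (hf.intervalIntegrable.continuousOn_mul hcont.continuousOn)]
  refine intervalIntegral.integral_congr_ae (Eventually.of_forall fun μ hμ => ?_)
  rw [dslope_of_ne _ (sub_ne_zero.1 (sub_ofReal_ne_zero hw μ)), slope_def_field, hfg μ hμ]
  ring

theorem cauchyTransform_eq_compl_add_dslope {f : ℝ → ℂ} (hf : Integrable f) {g : ℂ → ℂ} {a b : ℝ}
    (hab : a ≤ b) (hfg : ∀ μ ∈ Set.uIoc a b, g μ = f μ) {w : ℂ} (hw : w.im ≠ 0) :
    cauchyTransform f w =
      (∫ μ in (Set.uIoc a b)ᶜ, 1 / (2 * Real.pi * I) * (1 / (w - μ)) * f μ) +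
        1 / (2 * Real.pi * I) *
          (g w * (log (w - a) - log (w - b)) - ∫ μ in a..b, dslope g (μ : ℂ) w) := by
  rw [integral_dslope_eq hf hfg hw, sub_sub_cancel, cauchyTransform,
    ← integral_add_compl (measurableSet_uIoc (a := a) (b := b)) (integrable_cauchy_integrand hf hw),
    add_comm, ← intervalIntegral.integral_const_mul, intervalIntegral.integral_of_le hab,
    ← Set.uIoc_of_le hab]
  simp_rw [mul_assoc]

theorem differentiableOn_integral_compl_uIoc_cauchy {f : ℝ → ℂ} (hf : Integrable f) {x R : ℝ}
    (hR : 0 < R) :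
    DifferentiableOn ℂ (fun w : ℂ => ∫ μ in (Set.uIoc (x - 2 * R) (x + 2 * R))ᶜ,
      1 / (2 * Real.pi * I) * (1 / (w - μ)) * f μ) (Metric.ball (x : ℂ) R) := by
  refine differentiableOn_integral_cauchy hf.integrableOn Metric.isOpen_ball hR ?_
  filter_upwards [ae_restrict_mem measurableSet_uIoc.compl] with μ hμ w hw
  have hμx : 2 * R ≤ ‖(μ : ℂ) - x‖ := by
    rw [← ofReal_sub, norm_real, Real.norm_eq_abs]
    rw [Set.uIoc_of_le (by linarith), Set.mem_compl_iff, Set.mem_Ioc, not_and_or, not_lt,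
      not_le] at hμ
    rcases hμ with h | h
    · exact (by linarith : 2 * R ≤ -(μ - x)).trans (neg_le_abs _)
    · exact (by linarith : 2 * R ≤ μ - x).trans (le_abs_self _)
  have htri := norm_sub_le_norm_sub_add_norm_sub (μ : ℂ) w x
  rw [norm_sub_rev (μ : ℂ) w] at htri
  linarith [mem_ball_iff_norm.1 hw]

theorem differentiableOn_log_sub_sub_log_sub (x R : ℝ) :
    DifferentiableOn ℂ (fun w : ℂ => log (w - (x - 2 * R : ℝ)) - log ((x + 2 * R : ℝ) - w))
      (Metric.ball (x : ℂ) R) := by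
  have hre : ∀ w ∈ Metric.ball (x : ℂ) R, |w.re - x| < R := fun w hw =>
    (by simpa using abs_re_le_norm (w - x) : |w.re - x| ≤ ‖w - x‖).trans_lt
      (mem_ball_iff_norm.1 hw)
  refine (DifferentiableOn.clog (by fun_prop) fun w hw => ?_).sub
    (DifferentiableOn.clog (by fun_prop) fun w hw => ?_) <;>
  · refine mem_slitPlane_iff.2 (Or.inl ?_)
    have := abs_lt.1 (hre w hw)
    rw [sub_re, ofReal_re]
    linarith [this.1, this.2]

/-- Plemelj's jump relation, in the form of a continuation. -/
theorem exists_differentiableOn_eq_cauchyTransform {f : ℝ → ℂ} (hf : Integrable f) {x r R C : ℝ}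
    (hR : 0 < R) (hRr : 2 * R < r) {g : ℂ → ℂ} (hg : DifferentiableOn ℂ g (Metric.ball x r))
    (hC : ∀ z ∈ Metric.ball (x : ℂ) r, ‖deriv g z‖ ≤ C)
    (hfg : ∀ μ ∈ Metric.closedBall x (2 * R), g μ = f μ) :
    ∃ h : ℂ → ℂ, DifferentiableOn ℂ h (Metric.ball x R) ∧ ∀ w : ℂ,
      (0 < w.im → h w = cauchyTransform f w) ∧ (w.im < 0 → h w = cauchyTransform f w - g w) := by
  have hIcc : ∀ μ ∈ Set.uIcc (x - 2 * R) (x + 2 * R), μ ∈ Metric.closedBall x (2 * R) := by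
    rw [Set.uIcc_of_le (by linarith), Real.closedBall_eq_Icc]
    exact fun _ => id
  have hsub : Metric.ball (x : ℂ) R ⊆ Metric.ball (x : ℂ) r :=
    Metric.ball_subset_ball (by linarith)
  have hD := differentiableOn_integral_dslope (a := x - 2 * R) (b := x + 2 * R) Metric.isOpen_ball
    (convex_ball _ _) hg hC fun μ hμ => by
      rw [mem_ball_iff_norm, ← ofReal_sub, norm_real]
      exact (mem_closedBall_iff_norm.1 (hIcc μ hμ)).trans_lt hRr
  have hsplit : ∀ w : ℂ, w.im ≠ 0 → _ := fun w =>
    cauchyTransform_eq_compl_add_dslope hf (g := g) (a := x - 2 * R) (b := x + 2 * R)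
      (by linarith) fun μ hμ => hfg μ (hIcc μ (Set.uIoc_subset_uIcc hμ))
  refine ⟨_, (differentiableOn_integral_compl_uIoc_cauchy hf hR (x := x)).fun_add
    ((((hg.mono hsub).fun_mul ((differentiableOn_log_sub_sub_log_sub x R).sub_const
      (Real.pi * I))).fun_sub (hD.mono hsub)).const_mul (1 / (2 * Real.pi * I))), fun w =>
    ⟨fun hw => ?_, fun hw => ?_⟩⟩
  · rw [hsplit w hw.ne', ← neg_sub w ((x + 2 * R : ℝ) : ℂ),
      log_neg_of_im_pos (by simpa using hw)]
    ring
  · rw [hsplit w hw.ne, ← neg_sub ((x + 2 * R : ℝ) : ℂ) w, log_neg_of_im_pos (by simpa using hw)]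
    have hpi : (Real.pi : ℂ) ≠ 0 := ofReal_ne_zero.2 Real.pi_ne_zero
    field_simp
    ring

theorem exists_analyticAt_eq_cauchyTransform {f : ℝ → ℂ} (hf : Integrable f) {x : ℝ} {g : ℂ → ℂ}
    (hg : AnalyticAt ℂ g x) (hfg : ∀ᶠ y : ℝ in 𝓝 x, g y = f y) :
    ∃ h : ℂ → ℂ, AnalyticAt ℂ h x ∧ ∀ w : ℂ,
      (0 < w.im → h w = cauchyTransform f w) ∧ (w.im < 0 → h w = cauchyTransform f w - g w) := by
  have hderiv : ∀ᶠ z in 𝓝 (x : ℂ), ‖deriv g z‖ < ‖deriv g x‖ + 1 :=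
    hg.deriv.continuousAt.norm.eventually_lt_const (lt_add_one _)
  obtain ⟨r, hr, hball⟩ := Metric.eventually_nhds_iff_ball.1 (hg.eventually_analyticAt.and hderiv)
  obtain ⟨s, hs, hreal⟩ := Metric.eventually_nhds_iff_ball.1 hfg
  obtain ⟨h, hh, hjump⟩ := exists_differentiableOn_eq_cauchyTransform hf (x := x) (r := r)
    (R := min r s / 4) (div_pos (lt_min hr hs) four_pos) (by linarith [min_le_left r s])
    (fun z hz => (hball z hz).1.differentiableAt.differentiableWithinAt)
    (fun z hz => (hball z hz).2.le)
    fun μ hμ => hreal μ (Metric.closedBall_subset_ball (by linarith [min_le_right r s]) hμ)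
  exact ⟨h, hh.analyticAt (Metric.ball_mem_nhds _ (by positivity)), hjump⟩

theorem exists_analyticAt_eq_exp_neg_cauchyTransform {f : ℝ → ℂ} (hf : Integrable f) {x : ℝ}
    {G : ℂ → ℂ} (hG : AnalyticAt ℂ G x) (hGx : G x ∈ slitPlane)
    (hfG : ∀ᶠ y : ℝ in 𝓝 x, log (G y) = f y) :
    ∃ h : ℂ → ℂ, AnalyticAt ℂ h x ∧ ∀ᶠ w in 𝓝 (x : ℂ),
      (0 < w.im → h w = exp (-cauchyTransform f w)) ∧
        (w.im < 0 → h w = exp (-cauchyTransform f w) * G w) := by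
  obtain ⟨h, hh, hjump⟩ := exists_analyticAt_eq_cauchyTransform hf (hG.clog hGx) hfG
  refine ⟨fun w => exp (-h w), hh.neg.cexp, ?_⟩
  filter_upwards [hG.continuousAt.eventually_mem (isOpen_slitPlane.mem_nhds hGx)] with w hGw
  refine ⟨fun hw => by rw [(hjump w).1 hw], fun hw => ?_⟩
  rw [(hjump w).2 hw, neg_sub, sub_eq_neg_add, exp_add, exp_log (slitPlane_ne_zero hGw)]

/-! ### Continuation by a first order difference equation -/

section StepContinuation

theorem add_I_mul_im (z : ℂ) (h : ℝ) : (z + I * h).im = z.im + h := by simp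

theorem isOpen_lt_im (c : ℝ) : IsOpen {z : ℂ | c < z.im} :=
  isOpen_lt continuous_const continuous_im

theorem isOpen_im_lt (c : ℝ) : IsOpen {z : ℂ | z.im < c} :=
  isOpen_lt continuous_im continuous_const

theorem dense_im_ne (c : ℝ) : Dense {z : ℂ | z.im ≠ c} :=
  (dense_compl_singleton c).preimage isOpenMap_im

theorem exists_differentiableOn_eqOn_of_local {𝕜 E : Type*} [NontriviallyNormedField 𝕜]
    [NormedAddCommGroup E] [NormedSpace 𝕜 E] {S U : Set 𝕜} (hS : Dense S) {f : 𝕜 → E}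
    (hloc : ∀ z₀ ∈ U, ∃ h : 𝕜 → E, ∀ᶠ z in 𝓝 z₀, DifferentiableAt 𝕜 h z ∧ (z ∈ S → h z = f z)) :
    ∃ F : 𝕜 → E, (∀ z ∈ U, DifferentiableAt 𝕜 F z) ∧ Set.EqOn F f (S ∩ U) := by
  have hlim : ∀ {z₀ : 𝕜} {h : 𝕜 → E},
      (∀ᶠ z in 𝓝 z₀, DifferentiableAt 𝕜 h z ∧ (z ∈ S → h z = f z)) →
        limUnder (𝓝[S] z₀) f = h z₀ := fun {z₀ h} hh => by
    have : (𝓝[S] z₀).NeBot := mem_closure_iff_nhdsWithin_neBot.1 (hS z₀)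
    refine (hh.self_of_nhds.1.continuousAt.continuousWithinAt.tendsto.congr' ?_).limUnder_eq
    filter_upwards [nhdsWithin_le_nhds hh, self_mem_nhdsWithin] with z hz hzS using hz.2 hzS
  refine ⟨fun z => limUnder (𝓝[S] z) f, fun z₀ hz₀ => ?_, fun z₀ hz₀ => ?_⟩ <;>
    obtain ⟨h, hh⟩ := hloc z₀ (by first | exact hz₀ | exact hz₀.2)
  · exact hh.self_of_nhds.1.congr_of_eventuallyEq (hh.eventually_nhds.mono fun z => hlim)
  · exact (hlim hh).trans (hh.self_of_nhds.2 hz₀.1)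

/-- The extension of a function `f`, given for `c - ℏ < Im z`, to the whole plane by means of the
equation `F(z) = A(z) + B(z) F(z + iℏ)`. -/
def stepExtension {hbar : ℝ} (hh : 0 < hbar) (c : ℝ) (f A B : ℂ → ℂ) (z : ℂ) : ℂ :=
  if c - hbar < z.im then f z else A z + B z * stepExtension hh c f A B (z + I * hbar)
termination_by ⌈(c - z.im) / hbar⌉₊
decreasing_by
  rename_i hz
  rw [add_I_mul_im, ← sub_sub, sub_div, div_self hh.ne', Nat.ceil_sub_one]
  exact Nat.sub_lt (Nat.ceil_pos.2 (div_pos (by linarith) hh)) one_pos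

variable {c hbar : ℝ} {f A B : ℂ → ℂ}

theorem stepExtension_of_lt (hh : 0 < hbar) {z : ℂ} (hz : c - hbar < z.im) :
    stepExtension hh c f A B z = f z := by
  rw [stepExtension, if_pos hz]

theorem stepExtension_eq_add_mul (hh : 0 < hbar)
    (hstep : ∀ z : ℂ, c - hbar < z.im → z.im < c → f z = A z + B z * f (z + I * hbar)) {z : ℂ}
    (hz : z.im < c) :
    stepExtension hh c f A B z = A z + B z * stepExtension hh c f A B (z + I * hbar) := by
  rcases lt_or_ge (c - hbar) z.im with h | h
  · rw [stepExtension_of_lt hh h, hstep z h hz, stepExtension_of_lt hh]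
    rw [add_I_mul_im]
    linarith
  · rw [stepExtension, if_neg h.not_gt]

theorem differentiable_stepExtension (hh : 0 < hbar)
    (hf : ∀ z : ℂ, c - hbar < z.im → DifferentiableAt ℂ f z)
    (hA : DifferentiableOn ℂ A {z | z.im < c}) (hB : DifferentiableOn ℂ B {z | z.im < c})
    (hstep : ∀ z : ℂ, c - hbar < z.im → z.im < c → f z = A z + B z * f (z + I * hbar)) :
    Differentiable ℂ (stepExtension hh c f A B) := by
  suffices ∀ (n : ℕ) (z : ℂ), c - (n + 1) * hbar < z.im →
      DifferentiableAt ℂ (stepExtension hh c f A B) z by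
    intro z
    obtain ⟨n, hn⟩ := exists_nat_gt ((c - z.im) / hbar)
    exact this n z (by nlinarith [(div_lt_iff₀ hh).1 hn])
  have hbase : ∀ z : ℂ, c - hbar < z.im → DifferentiableAt ℂ (stepExtension hh c f A B) z :=
    fun z hz => (hf z hz).congr_of_eventuallyEq <|
      eventually_of_mem ((isOpen_lt_im _).mem_nhds hz) fun w => stepExtension_of_lt hh
  intro n
  induction n with
  | zero => exact fun z hz => hbase z (by simpa using hz)
  | succ n ih =>
    intro z hz
    rcases lt_or_ge z.im c with h | h
    · have hc := (isOpen_im_lt c).mem_nhds h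
      have hnext := ih (z + I * hbar) (by
        rw [add_I_mul_im]
        push_cast at hz
        linarith)
      exact ((hA.differentiableAt hc).add ((hB.differentiableAt hc).mul
        (hnext.comp z (differentiableAt_id.add_const _)))).congr_of_eventuallyEq <|
          eventually_of_mem hc fun w => stepExtension_eq_add_mul hh hstep
    · exact hbase z (by linarith)

theorem exists_strip_extension_of_step
    (hf : DifferentiableOn ℂ f {z | c < z.im}) (hA : DifferentiableOn ℂ A {z | z.im < c})
    (hB : DifferentiableOn ℂ B {z | z.im < c})
    (hloc : ∀ z₀ : ℂ, z₀.im = c → ∃ h : ℂ → ℂ, AnalyticAt ℂ h z₀ ∧ ∀ᶠ z in 𝓝 z₀,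
      (c < z.im → h z = f z) ∧ (z.im < c → h z = A z + B z * f (z + I * hbar))) :
    ∃ F : ℂ → ℂ, (∀ z : ℂ, c - hbar < z.im → DifferentiableAt ℂ F z) ∧
      (∀ z : ℂ, c - hbar < z.im → c < z.im → F z = f z) ∧
      ∀ z : ℂ, c - hbar < z.im → z.im < c → F z = A z + B z * f (z + I * hbar) := by
  let p : ℂ → ℂ := fun z => if c < z.im then f z else A z + B z * f (z + I * hbar)
  have hp_above : ∀ z : ℂ, c < z.im → p z = f z := fun z hz => if_pos hz
  have hp_below : ∀ z : ℂ, z.im < c → p z = A z + B z * f (z + I * hbar) := fun z hz =>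
    if_neg hz.not_gt
  obtain ⟨F, hF, hFp⟩ := exists_differentiableOn_eqOn_of_local (dense_im_ne c)
    (U := {z | c - hbar < z.im}) (f := p) fun z₀ hz₀ => by
      rcases lt_trichotomy z₀.im c with h | h | h
      · refine ⟨fun z => A z + B z * f (z + I * hbar), ?_⟩
        filter_upwards [(isOpen_lt_im _).mem_nhds hz₀, (isOpen_im_lt c).mem_nhds h] with z hz hzc
        have hc := (isOpen_im_lt c).mem_nhds hzc
        have hz' : z + I * hbar ∈ {w : ℂ | c < w.im} := by
          simpa only [Set.mem_ofPred_eq, add_I_mul_im, sub_lt_iff_lt_add] using hz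
        exact ⟨(hA.differentiableAt hc).add ((hB.differentiableAt hc).mul
          ((hf.differentiableAt ((isOpen_lt_im c).mem_nhds hz')).comp z
            (differentiableAt_id.add_const _))), fun _ => (hp_below z hzc).symm⟩
      · obtain ⟨k, hk, hkf⟩ := hloc z₀ h
        refine ⟨k, ?_⟩
        filter_upwards [hk.eventually_analyticAt, hkf] with z hz hzf
        refine ⟨hz.differentiableAt, fun hzc => ?_⟩
        rcases lt_or_gt_of_ne hzc with hz | hz
        · rw [hzf.2 hz, hp_below z hz]
        · rw [hzf.1 hz, hp_above z hz]
      · refine ⟨f, ?_⟩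
        filter_upwards [(isOpen_lt_im c).mem_nhds h] with z hz
        exact ⟨hf.differentiableAt ((isOpen_lt_im c).mem_nhds hz), fun _ => (hp_above z hz).symm⟩
  exact ⟨F, hF, fun z hz hzc => (hFp ⟨hzc.ne', hz⟩).trans (hp_above z hzc),
    fun z hz hzc => (hFp ⟨hzc.ne, hz⟩).trans (hp_below z hzc)⟩

theorem exists_entire_solution_of_step (hh : 0 < hbar)
    (hf : DifferentiableOn ℂ f {z | c < z.im}) (hA : DifferentiableOn ℂ A {z | z.im < c})
    (hB : DifferentiableOn ℂ B {z | z.im < c})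
    (hloc : ∀ z₀ : ℂ, z₀.im = c → ∃ h : ℂ → ℂ, AnalyticAt ℂ h z₀ ∧ ∀ᶠ z in 𝓝 z₀,
      (c < z.im → h z = f z) ∧ (z.im < c → h z = A z + B z * f (z + I * hbar))) :
    ∃ F : ℂ → ℂ, Differentiable ℂ F ∧ Set.EqOn F f {z | c < z.im} ∧
      ∀ z : ℂ, z.im < c → F z = A z + B z * F (z + I * hbar) := by
  obtain ⟨F, hF, hFf, hFstep⟩ := exists_strip_extension_of_step hf hA hB hloc
  have hstep : ∀ z : ℂ, c - hbar < z.im → z.im < c → F z = A z + B z * F (z + I * hbar) := by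
    intro z hz hzc
    rw [hFstep z hz hzc, hFf _ _ _] <;> rw [add_I_mul_im] <;> linarith
  refine ⟨stepExtension hh c F A B, differentiable_stepExtension hh hF hA hB hstep,
    fun z hz => ?_, fun z => stepExtension_eq_add_mul hh hstep⟩
  have hz : c < z.im := hz
  rw [stepExtension_of_lt hh (by linarith), hFf z (by linarith) hz]

end StepContinuation

/-! ### The functions `log V` and `V` near the real line -/

theorem exists_le_norm_ofReal_sub {u : ℂ} (hu : u.im ≠ 0) :
    ∃ c > 0, ∀ μ : ℝ, c * (1 + |μ|) ≤ ‖(μ : ℂ) - u‖ := by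
  have hd : 0 < |u.im| := abs_pos.2 hu
  refine ⟨|u.im| / (1 + ‖u‖ + |u.im|), by positivity, fun μ => ?_⟩
  rw [div_mul_eq_mul_div, div_le_iff₀ (by positivity)]
  have him : |u.im| ≤ ‖(μ : ℂ) - u‖ := by simpa using abs_im_le_norm ((μ : ℂ) - u)
  have hnorm : |μ| - ‖u‖ ≤ ‖(μ : ℂ) - u‖ := by simpa using norm_sub_norm_le (μ : ℂ) u
  nlinarith [norm_nonneg u]

section Monic

variable {N : ℕ} {r : Fin N → ℂ}

theorem exists_le_norm_monic (s : ℂ) (h : ∀ k, (r k - s).im ≠ 0) :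
    ∃ c > 0, ∀ μ : ℝ, c * (1 + |μ|) ^ N ≤ ‖monic r (μ + s)‖ := by
  choose c hc hcμ using fun k => exists_le_norm_ofReal_sub (h k)
  refine ⟨∏ k, c k, Finset.prod_pos fun k _ => hc k, fun μ => ?_⟩
  calc (∏ k, c k) * (1 + |μ|) ^ N = ∏ k, c k * (1 + |μ|) := by
        rw [Finset.prod_mul_distrib, Finset.prod_const, Finset.card_univ, Fintype.card_fin]
    _ ≤ ∏ k, ‖μ + s - r k‖ :=
        Finset.prod_le_prod (fun k _ => by have := hc k; positivity) fun k _ => by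
          rw [add_sub_assoc, ← neg_sub (r k) s, ← sub_eq_add_neg]
          exact hcμ k μ
    _ = ‖monic r (μ + s)‖ := (norm_prod _ _).symm

theorem monic_ne_zero_iff {z : ℂ} : monic r z ≠ 0 ↔ ∀ k, z ≠ r k := by
  simp [monic, Finset.prod_ne_zero_iff, sub_ne_zero]

theorem differentiable_monic (r : Fin N → ℂ) : Differentiable ℂ (monic r) := by
  unfold monic
  fun_prop

theorem monic_ne_zero_of_abs_im_lt {c : ℝ} (hr : ∀ k, |(r k).im| < c) {z : ℂ} (hz : c ≤ |z.im|) :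
    monic r z ≠ 0 :=
  monic_ne_zero_iff.2 fun k h => (hr k).not_ge (h ▸ hz)

theorem SelfConj.conj_monic (h : SelfConj r) (z : ℂ) :
    (starRingEnd ℂ) (monic r z) = monic r ((starRingEnd ℂ) z) := by
  obtain ⟨σ, hσ⟩ := h
  simp only [monic, map_prod, map_sub, hσ]
  exact Equiv.prod_comp σ fun k => (starRingEnd ℂ) z - r k

end Monic

theorem kernel_eq {hbar : ℝ} (hh : hbar ≠ 0) (x μ : ℝ) :
    (kernel hbar (x - μ) : ℂ) = 1 / (2 * Real.pi * I) * (1 / (x - I * hbar - μ)) -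
      1 / (2 * Real.pi * I) * (1 / (x + I * hbar - μ)) := by
  have hsub : (x : ℂ) - I * hbar - μ ≠ 0 := sub_ofReal_ne_zero (by simpa using hh) μ
  have hadd : (x : ℂ) + I * hbar - μ ≠ 0 := sub_ofReal_ne_zero (by simpa using hh) μ
  have hpi : (Real.pi : ℂ) ≠ 0 := ofReal_ne_zero.2 Real.pi_ne_zero
  have hprod : ((x : ℂ) - I * hbar - μ) * (x + I * hbar - μ) = (x - μ) ^ 2 + hbar ^ 2 := by
    linear_combination (-(hbar : ℂ) ^ 2) * I_sq
  have hsq : ((x : ℂ) - μ) ^ 2 + hbar ^ 2 ≠ 0 := hprod ▸ mul_ne_zero hsub hadd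
  rw [← mul_sub, div_sub_div _ _ hsub hadd, hprod, kernel]
  push_cast
  field_simp
  ring

theorem integral_kernel_mul {hbar : ℝ} (hh : hbar ≠ 0) {f : ℝ → ℂ} (hf : Integrable f) (x : ℝ) :
    ∫ μ : ℝ, (kernel hbar (x - μ) : ℂ) * f μ =
      cauchyTransform f (x - I * hbar) - cauchyTransform f (x + I * hbar) := by
  rw [cauchyTransform, cauchyTransform, ← integral_sub
    (integrable_cauchy_integrand hf (by simpa using hh))
    (integrable_cauchy_integrand hf (by simpa using hh))]
  simp only [kernel_eq hh, sub_mul]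

theorem integrable_one_div_one_add_abs_pow {n : ℕ} (hn : 2 ≤ n) :
    Integrable fun μ : ℝ => 1 / (1 + |μ|) ^ n := by
  have h := integrable_one_add_norm (E := ℝ) (μ := volume) (r := n)
    (by simpa using Nat.lt_of_succ_le hn)
  simpa only [Real.norm_eq_abs, Real.rpow_neg (add_nonneg zero_le_one (abs_nonneg _)),
    Real.rpow_natCast, one_div] using h

section LogV

variable {hbar ρ : ℝ} {N : ℕ} {δ : Fin N → ℂ} {Y : ℝ → ℝ}

theorem monic_sub_ne_zero (him : ∀ k, |(δ k).im| < hbar / 2) (μ : ℝ) :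
    monic δ ((μ : ℂ) - I * hbar / 2) ≠ 0 :=
  monic_ne_zero_of_abs_im_lt him (by simpa using le_abs_self (hbar / 2))

theorem monic_add_ne_zero (him : ∀ k, |(δ k).im| < hbar / 2) (μ : ℝ) :
    monic δ ((μ : ℂ) + I * hbar / 2) ≠ 0 :=
  monic_ne_zero_of_abs_im_lt him (by simpa using le_abs_self (hbar / 2))

theorem one_le_V (hρ : 0 ≤ ρ) {μ : ℝ} (hY : 0 ≤ Y μ) : 1 ≤ V hbar ρ δ Y μ :=
  le_add_of_nonneg_right (by positivity)

theorem continuous_V (him : ∀ k, |(δ k).im| < hbar / 2) (hY : Continuous Y) :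
    Continuous (V hbar ρ δ Y) := by
  have hm : Continuous fun μ : ℝ => monic δ ((μ : ℂ) - I * hbar / 2) :=
    (differentiable_monic δ).continuous.comp (by fun_prop)
  exact continuous_const.add ((continuous_const.mul hY).div (hm.norm.pow 2) fun μ =>
    pow_ne_zero 2 (norm_ne_zero_iff.2 (monic_sub_ne_zero him μ)))

theorem exists_V_sub_one_le (hρ : 0 ≤ ρ) (him : ∀ k, |(δ k).im| < hbar / 2) {C : ℝ}
    (hY : ∀ x, Y x ≤ C) : ∃ D, ∀ μ, V hbar ρ δ Y μ - 1 ≤ D / (1 + |μ|) ^ (2 * N) := by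
  obtain ⟨c, hc, hcm⟩ := exists_le_norm_monic (r := δ) (-(I * hbar / 2)) fun k h => by
    have hδ := (abs_lt.1 (him k)).1
    simp only [sub_neg_eq_add, add_im, div_ofNat_im, mul_im, I_re, I_im, ofReal_re, ofReal_im,
      zero_mul, one_mul, zero_add] at h
    linarith
  refine ⟨ρ ^ hbar * max C 0 / c ^ 2, fun μ => ?_⟩
  have hm : c * (1 + |μ|) ^ N ≤ ‖monic δ ((μ : ℂ) - I * hbar / 2)‖ := hcm μ
  have hC : Y μ ≤ max C 0 := (hY μ).trans (le_max_left C 0)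
  calc V hbar ρ δ Y μ - 1 = ρ ^ hbar * Y μ / ‖monic δ ((μ : ℂ) - I * hbar / 2)‖ ^ 2 :=
        add_sub_cancel_left _ _
    _ ≤ ρ ^ hbar * max C 0 / (c * (1 + |μ|) ^ N) ^ 2 := by gcongr
    _ = ρ ^ hbar * max C 0 / c ^ 2 / (1 + |μ|) ^ (2 * N) := by
        rw [mul_pow, ← pow_mul, mul_comm N 2, div_div]

/-- The density `log V`, as a complex-valued function. -/
def logV (hbar ρ : ℝ) {N : ℕ} (δ : Fin N → ℂ) (Y : ℝ → ℝ) (μ : ℝ) : ℂ :=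
  Real.log (V hbar ρ δ Y μ)

theorem IsNLIESolution.continuous (hY : IsNLIESolution hbar ρ δ Y) : Continuous Y :=
  hY.continuous_log.rexp.congr fun x => Real.exp_log (hY.pos x)

theorem continuous_logV (hρ : 0 ≤ ρ) (him : ∀ k, |(δ k).im| < hbar / 2)
    (hY : IsNLIESolution hbar ρ δ Y) : Continuous (logV hbar ρ δ Y) :=
  continuous_ofReal.comp ((continuous_V him hY.continuous).log fun μ =>
    (zero_lt_one.trans_le (one_le_V hρ (hY.pos μ).le)).ne')

theorem exists_norm_logV_le (hρ : 0 ≤ ρ) (him : ∀ k, |(δ k).im| < hbar / 2)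
    (hY : IsNLIESolution hbar ρ δ Y) :
    ∃ D, ∀ μ, ‖logV hbar ρ δ Y μ‖ ≤ D / (1 + |μ|) ^ (2 * N) := by
  obtain ⟨C, hC⟩ := hY.log_bounded
  obtain ⟨D, hD⟩ := exists_V_sub_one_le hρ him fun x =>
    (Real.log_le_iff_le_exp (hY.pos x)).1 (hC x)
  refine ⟨D, fun μ => le_trans ?_ (hD μ)⟩
  have hV := one_le_V (hbar := hbar) (δ := δ) hρ (hY.pos μ).le
  rw [logV, norm_real, Real.norm_of_nonneg (Real.log_nonneg hV)]
  exact Real.log_le_sub_one_of_pos (zero_lt_one.trans_le hV)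

theorem integrable_logV (hN : N ≠ 0) (hρ : 0 ≤ ρ) (him : ∀ k, |(δ k).im| < hbar / 2)
    (hY : IsNLIESolution hbar ρ δ Y) : Integrable (logV hbar ρ δ Y) := by
  obtain ⟨D, hD⟩ := exists_norm_logV_le hρ him hY
  refine ((integrable_one_div_one_add_abs_pow (n := 2 * N) (by lia)).const_mul D).mono'
    (continuous_logV hρ him hY).aestronglyMeasurable (Eventually.of_forall fun μ => ?_)
  rw [mul_one_div]
  exact hD μ

/-- The Cauchy transform `T` of `log V`, so that `v_↑(z) = exp (-T(z + iℏ/2))` and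
`v_↓(z - iℏ) = exp (T(z - iℏ/2))`. -/
def cauchyLogV (hbar ρ : ℝ) {N : ℕ} (δ : Fin N → ℂ) (Y : ℝ → ℝ) : ℂ → ℂ :=
  cauchyTransform (logV hbar ρ δ Y)

theorem vUp_eq (z : ℂ) :
    vUp hbar ρ δ Y z = exp (-cauchyLogV hbar ρ δ Y (z + I * hbar / 2)) := by
  simp only [vUp, cauchyLogV, cauchyTransform, logV, sub_add_eq_add_sub]

theorem vDownShift_eq (z : ℂ) :
    vDownShift hbar ρ δ Y z = exp (cauchyLogV hbar ρ δ Y (z - I * hbar / 2)) := by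
  simp only [vDownShift, cauchyLogV, cauchyTransform, logV, sub_right_comm]

theorem ofReal_log_Y (hh : hbar ≠ 0) (hi : Integrable (logV hbar ρ δ Y))
    (hY : IsNLIESolution hbar ρ δ Y) (x : ℝ) :
    (Real.log (Y x) : ℂ) =
      cauchyLogV hbar ρ δ Y (x - I * hbar) - cauchyLogV hbar ρ δ Y (x + I * hbar) := by
  rw [hY.equation x, cauchyLogV, ← integral_kernel_mul hh hi, ← integral_complex_ofReal]
  simp only [logV, ofReal_mul]

/-- The function `1 + ρ^ℏ exp (T(w - iℏ) - T(w + iℏ)) / (ϑ(w - iℏ/2) ϑ(w + iℏ/2))`. By the nonlinear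
integral equation it extends `V` to the points of the strip `|Im w| < ℏ` where the denominator does
not vanish. -/
def VExt (hbar ρ : ℝ) {N : ℕ} (δ : Fin N → ℂ) (Y : ℝ → ℝ) (w : ℂ) : ℂ :=
  1 + ((ρ ^ hbar : ℝ) : ℂ) *
    exp (cauchyLogV hbar ρ δ Y (w - I * hbar) - cauchyLogV hbar ρ δ Y (w + I * hbar)) /
      (monic δ (w - I * hbar / 2) * monic δ (w + I * hbar / 2))

theorem VExt_ofReal (hh : hbar ≠ 0) (hδ : SelfConj δ) (hi : Integrable (logV hbar ρ δ Y))
    (hY : IsNLIESolution hbar ρ δ Y) (x : ℝ) : VExt hbar ρ δ Y x = V hbar ρ δ Y x := by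
  have hconj : monic δ ((x : ℂ) + I * hbar / 2) =
      (starRingEnd ℂ) (monic δ ((x : ℂ) - I * hbar / 2)) := by
    rw [hδ.conj_monic]
    congr 1
    simp only [map_sub, map_div₀, map_mul, conj_I, conj_ofReal, map_ofNat]
    ring
  rw [VExt, ← ofReal_log_Y hh hi hY, ← ofReal_exp, Real.exp_log (hY.pos x), hconj, mul_conj,
    normSq_eq_norm_sq, V]
  push_cast
  rfl

theorem analyticAt_VExt_ofReal (hh : hbar ≠ 0) (him : ∀ k, |(δ k).im| < hbar / 2)
    (hi : Integrable (logV hbar ρ δ Y)) (x : ℝ) : AnalyticAt ℂ (VExt hbar ρ δ Y) x := by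
  have hm := fun z => (differentiable_monic δ).analyticAt z
  have hT : ∀ {w : ℂ}, w.im ≠ 0 → AnalyticAt ℂ (cauchyLogV hbar ρ δ Y) w :=
    analyticAt_cauchyTransform hi
  have hsub : AnalyticAt ℂ (fun w => cauchyLogV hbar ρ δ Y (w - I * hbar)) x :=
    (hT (by simpa using hh)).fun_comp (by fun_prop)
  have hadd : AnalyticAt ℂ (fun w => cauchyLogV hbar ρ δ Y (w + I * hbar)) x :=
    (hT (by simpa using hh)).fun_comp (by fun_prop)
  exact analyticAt_const.fun_add (((analyticAt_const.fun_mul (hsub.fun_sub hadd).cexp).fun_div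
    (((hm _).fun_comp (by fun_prop)).fun_mul ((hm _).fun_comp (by fun_prop))))
    (mul_ne_zero (monic_sub_ne_zero him x) (monic_add_ne_zero him x)))

theorem exists_analyticAt_eq_exp_neg_cauchyLogV (hh : hbar ≠ 0) (hρ : 0 ≤ ρ) (hδ : SelfConj δ)
    (him : ∀ k, |(δ k).im| < hbar / 2) (hi : Integrable (logV hbar ρ δ Y))
    (hY : IsNLIESolution hbar ρ δ Y) (x : ℝ) :
    ∃ h : ℂ → ℂ, AnalyticAt ℂ h x ∧ ∀ᶠ w in 𝓝 (x : ℂ),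
      (0 < w.im → h w = exp (-cauchyLogV hbar ρ δ Y w)) ∧
        (w.im < 0 → h w = exp (-cauchyLogV hbar ρ δ Y w) * VExt hbar ρ δ Y w) := by
  have hV : ∀ y, 0 < V hbar ρ δ Y y := fun y =>
    zero_lt_one.trans_le (one_le_V hρ (hY.pos y).le)
  refine exists_analyticAt_eq_exp_neg_cauchyTransform hi (analyticAt_VExt_ofReal hh him hi x) ?_
    (Eventually.of_forall fun y => ?_)
  · rw [VExt_ofReal hh hδ hi hY]
    exact ofReal_mem_slitPlane.2 (hV x)
  · rw [VExt_ofReal hh hδ hi hY, logV, ofReal_log (hV y).le]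

end LogV

/-! ### The explicit factors of `Q⁺` and `Q⁻` -/

/-- The factor of `Q⁺` that does not involve `v_↑`. -/
def prefPlus (hbar g κ : ℝ) {N : ℕ} (δ : Fin N → ℂ) (z : ℂ) : ℂ :=
  ((κ * g ^ N : ℝ) : ℂ) ^ (-I * z) * (hbar : ℂ) ^ (I * N * z / hbar) *
    exp (-(N * Real.pi * z / hbar)) / ∏ k, Gamma (1 - I * (z - δ k) / hbar)

/-- The factor of `Q⁻` that does not involve `v_↓`. -/
def prefMinus (hbar g : ℝ) {N : ℕ} (δ : Fin N → ℂ) (z : ℂ) : ℂ :=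
  (g : ℂ) ^ (I * N * z) * (hbar : ℂ) ^ (-(I * N * z / hbar)) *
    exp (-(N * Real.pi * z / hbar)) / ∏ k, Gamma (1 + I * (z - δ k) / hbar)

/-- The constant `(-i g^{-ℏ})^N`, which the prefactors of `Q^±` pick up under shifts by `iℏ`. -/
def shiftConst (hbar g : ℝ) (N : ℕ) : ℂ := (-I / ((g ^ hbar : ℝ) : ℂ)) ^ N

/-- The constant `s` such that `Q⁺(z) = exp (z s) v_↑(z) / ∏ₖ Γ(1 - i(z - δₖ)/ℏ)`, where `a` stands
for `κ g^N`. -/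
def prefPlusExponent (hbar a : ℝ) (N : ℕ) : ℂ :=
  -I * Real.log a + (I * N * Real.log hbar - N * Real.pi) / hbar

theorem ofReal_cpow_eq_exp {x : ℝ} (hx : 0 < x) (s : ℂ) : (x : ℂ) ^ s = exp (Real.log x * s) := by
  rw [cpow_def_of_ne_zero (ofReal_ne_zero.2 hx.ne'), ofReal_log hx.le]

section Prefactors

variable {hbar g κ : ℝ} {N : ℕ} {δ : Fin N → ℂ}

theorem prefPlus_eq (hh : 0 < hbar) (ha : 0 < κ * g ^ N) (z : ℂ) :
    prefPlus hbar g κ δ z = exp (z * prefPlusExponent hbar (κ * g ^ N) N) *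
      (∏ k, Gamma (1 - I * (z - δ k) / hbar))⁻¹ := by
  rw [prefPlus, ofReal_cpow_eq_exp ha, ofReal_cpow_eq_exp hh, ← exp_add, ← exp_add, div_eq_mul_inv,
    prefPlusExponent]
  congr 2
  ring

theorem differentiable_prefPlus (hh : 0 < hbar) (ha : 0 < κ * g ^ N) :
    Differentiable ℂ (prefPlus hbar g κ δ) := by
  rw [funext (prefPlus_eq (δ := δ) hh ha)]
  simp_rw [← Finset.prod_inv_distrib]
  exact Differentiable.fun_mul (by fun_prop) (Differentiable.fun_finsetProd fun k _ =>
    differentiable_one_div_Gamma.comp (by fun_prop))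

theorem prefPlus_ne_zero (hh : 0 < hbar) (ha : 0 < κ * g ^ N) {z : ℂ}
    (hz : ∀ k, (δ k).im < z.im + hbar) : prefPlus hbar g κ δ z ≠ 0 := by
  rw [prefPlus_eq hh ha]
  refine mul_ne_zero (exp_ne_zero _) (inv_ne_zero (Finset.prod_ne_zero_iff.2 fun k _ =>
    Gamma_ne_zero_of_re_pos ?_))
  have hre : (1 - I * (z - δ k) / hbar).re = (z.im + hbar - (δ k).im) / hbar := by
    simp only [sub_re, one_re, div_ofReal_re, mul_re, I_re, I_im, sub_im, zero_mul, one_mul]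
    field_simp
    ring
  rw [hre]
  exact div_pos (sub_pos.2 (hz k)) hh

theorem exp_I_mul_mul_prefPlusExponent (hh : 0 < hbar) {a : ℝ} (ha : 0 < a) :
    exp (I * hbar * prefPlusExponent hbar a N) = ((a ^ hbar : ℝ) : ℂ) * (-1 / hbar) ^ N := by
  have hhc : (hbar : ℂ) ≠ 0 := ofReal_ne_zero.2 hh.ne'
  have hs : I * hbar * prefPlusExponent hbar a N =
      Real.log a * hbar + N * (-Real.log hbar + -(Real.pi * I)) := by
    rw [prefPlusExponent]
    field_simp
    linear_combination (-(hbar * Real.log a) + N * Real.log hbar : ℂ) * I_sq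
  have hexp : exp (-(Real.log hbar : ℂ) + -(Real.pi * I)) = -1 / hbar := by
    rw [exp_add, exp_neg, exp_neg, exp_pi_mul_I, ← ofReal_exp, Real.exp_log hh]
    norm_num
    field_simp
  rw [hs, exp_add, exp_nat_mul, hexp, ofReal_cpow ha.le, ofReal_cpow_eq_exp ha]

theorem inv_prod_Gamma_one_sub (hh : hbar ≠ 0) (z : ℂ) :
    (∏ k, Gamma (1 - I * (z - δ k) / hbar))⁻¹ = (-I / hbar) ^ N * monic δ (z + I * hbar) *
      (∏ k, Gamma (1 - I * (z + I * hbar - δ k) / hbar))⁻¹ := by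
  have hhc : (hbar : ℂ) ≠ 0 := ofReal_ne_zero.2 hh
  have hlin : ∀ k, 1 - I * (z - δ k) / hbar = -I / hbar * (z + I * hbar - δ k) := fun k => by
    field_simp
    linear_combination (hbar : ℂ) * I_sq
  have hadd : ∀ k, 1 - I * (z - δ k) / hbar + 1 = 1 - I * (z + I * hbar - δ k) / hbar := fun k => by
    field_simp
    linear_combination (hbar : ℂ) * I_sq
  calc (∏ k, Gamma (1 - I * (z - δ k) / hbar))⁻¹
      = ∏ k, -I / hbar * (z + I * hbar - δ k) *
          (Gamma (1 - I * (z + I * hbar - δ k) / hbar))⁻¹ := by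
        rw [← Finset.prod_inv_distrib]
        refine Finset.prod_congr rfl fun k _ => ?_
        rw [one_div_Gamma_eq_self_mul_one_div_Gamma_add_one, hadd, hlin]
    _ = _ := by
        rw [Finset.prod_mul_distrib, Finset.prod_mul_distrib, Finset.prod_inv_distrib,
          Finset.prod_const, Finset.card_univ, Fintype.card_fin, monic]

theorem shiftConst_ne_zero (hg : 0 < g) : shiftConst hbar g N ≠ 0 :=
  pow_ne_zero _ (div_ne_zero (neg_ne_zero.2 I_ne_zero)
    (ofReal_ne_zero.2 (Real.rpow_pos_of_pos hg _).ne'))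

theorem neg_I_pow_mul_rpow (hg : 0 < g) (hκ : 0 ≤ κ) :
    (-I) ^ N * (((κ * g ^ N) ^ hbar : ℝ) : ℂ) =
      (((κ * g ^ (2 * N)) ^ hbar : ℝ) : ℂ) * shiftConst hbar g N := by
  have hne : ((g ^ hbar : ℝ) : ℂ) ≠ 0 := ofReal_ne_zero.2 (Real.rpow_pos_of_pos hg _).ne'
  have hρ : κ * g ^ (2 * N) = κ * g ^ N * g ^ N := by ring
  rw [hρ, Real.mul_rpow (x := κ * g ^ N) (by positivity) (by positivity),
    ← Real.rpow_pow_comm hg.le, shiftConst, div_pow, ofReal_mul, ofReal_pow]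
  field_simp

theorem monic_mul_prefPlus_add (hh : 0 < hbar) (hg : 0 < g) (hκ : 0 < κ) (z : ℂ) :
    monic δ (z + I * hbar) * prefPlus hbar g κ δ (z + I * hbar) =
      (((κ * g ^ (2 * N)) ^ hbar : ℝ) : ℂ) * shiftConst hbar g N * prefPlus hbar g κ δ z := by
  have ha : 0 < κ * g ^ N := by positivity
  have hI : (-1 / hbar : ℂ) = -I * (-I / hbar) := by
    rw [mul_div_assoc', neg_mul_neg, I_mul_I]
  rw [← neg_I_pow_mul_rpow hg hκ.le, prefPlus_eq hh ha, prefPlus_eq hh ha,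
    inv_prod_Gamma_one_sub hh.ne' z, add_mul, exp_add, exp_I_mul_mul_prefPlusExponent hh ha, hI,
    mul_pow]
  ring

theorem prefMinus_eq_conj (hh : 0 < hbar) (hg : 0 < g) (hκ : 0 < κ) (hδ : SelfConj δ) (z : ℂ) :
    prefMinus hbar g δ z =
      exp (-I * Real.log κ * z) * (starRingEnd ℂ) (prefPlus hbar g κ δ ((starRingEnd ℂ) z)) := by
  obtain ⟨σ, hσ⟩ := hδ
  have hΓ : (starRingEnd ℂ) (∏ k, Gamma (1 - I * ((starRingEnd ℂ) z - δ k) / hbar)) =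
      ∏ k, Gamma (1 + I * (z - δ k) / hbar) := by
    rw [map_prod, ← Equiv.prod_comp σ fun k => Gamma (1 + I * (z - δ k) / hbar)]
    refine Finset.prod_congr rfl fun k _ => ?_
    rw [← Gamma_conj, ← hσ]
    congr 1
    simp only [map_sub, map_one, map_div₀, map_mul, conj_I, conj_conj, conj_ofReal]
    ring
  have hlog : Real.log (κ * g ^ N) = Real.log κ + N * Real.log g := by
    rw [Real.log_mul hκ.ne' (by positivity), Real.log_pow]
  rw [prefPlus_eq hh (by positivity), map_mul, map_inv₀, hΓ, ← exp_conj, ← mul_assoc, ← exp_add,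
    prefMinus, ofReal_cpow_eq_exp hg, ofReal_cpow_eq_exp hh, ← exp_add, ← exp_add, div_eq_mul_inv,
    prefPlusExponent, hlog]
  congr 2
  simp only [map_add, map_sub, map_neg, map_div₀, map_mul, conj_I, conj_conj, conj_ofReal,
    map_natCast, ofReal_add, ofReal_mul, ofReal_natCast]
  ring

theorem differentiable_prefMinus (hh : 0 < hbar) (hg : 0 < g) (hδ : SelfConj δ) :
    Differentiable ℂ (prefMinus hbar g δ) := by
  rw [funext fun z => prefMinus_eq_conj hh hg one_pos hδ z]
  refine Differentiable.fun_mul (by fun_prop) fun z => ?_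
  have h := (differentiable_prefPlus (δ := δ) (g := g) (κ := 1) hh (by positivity)
    ((starRingEnd ℂ) z)).conj_conj
  rwa [conj_conj] at h

theorem prefMinus_ne_zero (hh : 0 < hbar) (hg : 0 < g) (hδ : SelfConj δ) {z : ℂ}
    (hz : ∀ k, (δ k).im < -z.im + hbar) : prefMinus hbar g δ z ≠ 0 := by
  rw [prefMinus_eq_conj hh hg one_pos hδ]
  exact mul_ne_zero (exp_ne_zero _) ((map_ne_zero _).2
    (prefPlus_ne_zero hh (by positivity) (by simpa only [conj_im] using hz)))

theorem prefMinus_add (hh : 0 < hbar) (hg : 0 < g) (hδ : SelfConj δ) (z : ℂ) :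
    prefMinus hbar g δ (z + I * hbar) =
      shiftConst hbar g N * monic δ z * prefMinus hbar g δ z := by
  have hne : ((g ^ hbar : ℝ) : ℂ) ≠ 0 := ofReal_ne_zero.2 (Real.rpow_pos_of_pos hg _).ne'
  have hconj : (starRingEnd ℂ) (z + I * hbar) + I * hbar = (starRingEnd ℂ) z := by
    simp only [map_add, map_mul, conj_I, conj_ofReal]
    ring
  have hp := congrArg (starRingEnd ℂ) (monic_mul_prefPlus_add (δ := δ) (κ := 1) hh hg one_pos
    ((starRingEnd ℂ) (z + I * hbar)))
  have hc : shiftConst hbar g N * ((starRingEnd ℂ) (((1 * g ^ (2 * N)) ^ hbar : ℝ) : ℂ) *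
      (starRingEnd ℂ) (shiftConst hbar g N)) = 1 := by
    rw [← map_mul, ← neg_I_pow_mul_rpow hg zero_le_one, shiftConst, one_mul,
      ← Real.rpow_pow_comm hg.le, ofReal_pow, ← mul_pow, map_pow, ← mul_pow, map_mul, map_neg,
      conj_I, conj_ofReal, neg_neg, mul_comm I, ← mul_assoc, div_mul_cancel₀ _ hne, neg_mul,
      I_mul_I, neg_neg, one_pow]
  rw [hconj, map_mul, map_mul, map_mul, hδ.conj_monic, conj_conj] at hp
  simp only [prefMinus_eq_conj hh hg one_pos hδ, Real.log_one, ofReal_zero, mul_zero, zero_mul,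
    exp_zero, one_mul]
  rw [mul_assoc, hp, ← mul_assoc, hc, one_mul]

end Prefactors

theorem vDownShift_eq_conj {hbar ρ : ℝ} {N : ℕ} {δ : Fin N → ℂ} {Y : ℝ → ℝ} (z : ℂ) :
    vDownShift hbar ρ δ Y z = (starRingEnd ℂ) (vUp hbar ρ δ Y ((starRingEnd ℂ) z)) := by
  rw [vDownShift, vUp, ← exp_conj, map_neg, ← integral_conj, ← integral_neg]
  congr 2 with μ
  simp only [map_mul, map_div₀, map_one, map_add, map_sub, conj_I, conj_conj, conj_ofReal,
    map_ofNat]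
  rw [neg_mul, neg_div, ← sub_eq_add_neg, mul_neg, div_neg, neg_mul, neg_mul, neg_neg]

/-! ### The entire functions `Q⁺` and `Q⁻` -/

section Continuation

variable {hbar ρ : ℝ} {N : ℕ} {δ : Fin N → ℂ} {Y : ℝ → ℝ}

theorem differentiableAt_vUp (hi : Integrable (logV hbar ρ δ Y)) {z : ℂ}
    (hz : z.im ≠ -(hbar / 2)) : DifferentiableAt ℂ (vUp hbar ρ δ Y) z := by
  rw [funext (vUp_eq (hbar := hbar) (ρ := ρ) (δ := δ) (Y := Y))]
  have him : (z + I * hbar / 2).im ≠ 0 := by simpa [← eq_neg_iff_add_eq_zero] using hz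
  exact ((analyticAt_cauchyTransform hi him).differentiableAt.fun_comp' z
    (by fun_prop)).fun_neg.cexp

theorem differentiableAt_vDownShift (hi : Integrable (logV hbar ρ δ Y)) {z : ℂ}
    (hz : z.im ≠ hbar / 2) : DifferentiableAt ℂ (vDownShift hbar ρ δ Y) z := by
  rw [funext (vDownShift_eq (hbar := hbar) (ρ := ρ) (δ := δ) (Y := Y))]
  have him : (z - I * hbar / 2).im ≠ 0 := by simpa [sub_eq_zero] using hz
  exact ((analyticAt_cauchyTransform hi him).differentiableAt.fun_comp' z (by fun_prop)).cexp

theorem vUp_mul_vDownShift_add (z : ℂ) :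
    vUp hbar ρ δ Y z * vDownShift hbar ρ δ Y (z + I * hbar) = 1 := by
  have hz : z + I * hbar - I * hbar / 2 = z + I * hbar / 2 := by ring
  rw [vUp_eq, vDownShift_eq, hz, ← exp_add, neg_add_cancel, exp_zero]

theorem VExt_add (z : ℂ) :
    VExt hbar ρ δ Y (z + I * hbar / 2) =
      1 + ((ρ ^ hbar : ℝ) : ℂ) * (vUp hbar ρ δ Y (z + I * hbar) * vDownShift hbar ρ δ Y z) /
        (monic δ z * monic δ (z + I * hbar)) := by
  rw [VExt, vUp_eq, vDownShift_eq, ← exp_add]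
  ring_nf

theorem exists_analyticAt_eq_vUp (hh : hbar ≠ 0) (hρ : 0 ≤ ρ) (hδ : SelfConj δ)
    (him : ∀ k, |(δ k).im| < hbar / 2) (hi : Integrable (logV hbar ρ δ Y))
    (hY : IsNLIESolution hbar ρ δ Y) {z₀ : ℂ} (hz₀ : z₀.im = -(hbar / 2)) :
    ∃ h : ℂ → ℂ, AnalyticAt ℂ h z₀ ∧ ∀ᶠ z in 𝓝 z₀,
      (-(hbar / 2) < z.im → h z = vUp hbar ρ δ Y z) ∧
      (z.im < -(hbar / 2) → h z = vUp hbar ρ δ Y z * (1 + ((ρ ^ hbar : ℝ) : ℂ) *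
        (vUp hbar ρ δ Y (z + I * hbar) * vDownShift hbar ρ δ Y z) /
          (monic δ z * monic δ (z + I * hbar)))) := by
  obtain ⟨h, hh, hev⟩ := exists_analyticAt_eq_exp_neg_cauchyLogV hh hρ hδ him hi hY z₀.re
  have hre : z₀ + I * hbar / 2 = z₀.re := Complex.ext (by simp) (by simp [hz₀])
  rw [← hre] at hh hev
  have hshift : AnalyticAt ℂ (fun z : ℂ => z + I * hbar / 2) z₀ := by fun_prop
  refine ⟨fun z => h (z + I * hbar / 2), hh.fun_comp_of_eq hshift rfl, ?_⟩
  filter_upwards [hshift.continuousAt.eventually hev] with z hz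
  have hzim : (z + I * hbar / 2).im = z.im + hbar / 2 := by simp
  rw [hzim] at hz
  rw [vUp_eq, ← VExt_add]
  exact ⟨fun h => hz.1 (by linarith), fun h => hz.2 (by linarith)⟩

theorem eq_of_eqOn_of_isOpen {F G : ℂ → ℂ} (hF : Differentiable ℂ F) (hG : Differentiable ℂ G)
    {U : Set ℂ} (hU : IsOpen U) (hne : U.Nonempty) (h : Set.EqOn F G U) : F = G := by
  obtain ⟨z₀, hz₀⟩ := hne
  exact AnalyticOnNhd.eq_of_eventuallyEq (fun z _ => hF.analyticAt z) (fun z _ => hG.analyticAt z)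
    (h.eventuallyEq_of_mem (hU.mem_nhds hz₀))

theorem entireContinuation_eq {U : Set ℂ} (hU : IsOpen U) (hne : U.Nonempty) {f F : ℂ → ℂ}
    (hF : Differentiable ℂ F) (h : Set.EqOn F f U) : entireContinuation U f = F := by
  have hex : ∃ F : ℂ → ℂ, Differentiable ℂ F ∧ Set.EqOn F f U := ⟨F, hF, h⟩
  rw [entireContinuation, dif_pos hex]
  exact eq_of_eqOn_of_isOpen hex.choose_spec.1 hF hU hne (hex.choose_spec.2.trans h.symm)

end Continuation

section BaxterFunctions

variable {hbar g κ : ℝ} {N : ℕ} {δ : Fin N → ℂ} {Y : ℝ → ℝ}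

/-- The jump factor of `v_↑` across `Im z = -ℏ/2` and the quasi-periodicity of `prefPlus` together
form the recursion for `prefPlus * vUp`. -/
theorem exists_analyticAt_eq_prefPlus_mul_vUp (hh : 0 < hbar) (hg : 0 < g) (hκ : 0 < κ)
    (hδ : SelfConj δ) (him : ∀ k, |(δ k).im| < hbar / 2)
    (hi : Integrable (logV hbar (κ * g ^ (2 * N)) δ Y))
    (hY : IsNLIESolution hbar (κ * g ^ (2 * N)) δ Y) {z₀ : ℂ} (hz₀ : z₀.im = -(hbar / 2)) :
    ∃ h : ℂ → ℂ, AnalyticAt ℂ h z₀ ∧ ∀ᶠ z in 𝓝 z₀,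
      (-(hbar / 2) < z.im → h z = prefPlus hbar g κ δ z * vUp hbar (κ * g ^ (2 * N)) δ Y z) ∧
      (z.im < -(hbar / 2) → h z =
        vUp hbar (κ * g ^ (2 * N)) δ Y z * prefPlus hbar g κ δ z +
          vUp hbar (κ * g ^ (2 * N)) δ Y z * vDownShift hbar (κ * g ^ (2 * N)) δ Y z /
            (shiftConst hbar g N * monic δ z) *
          (prefPlus hbar g κ δ (z + I * hbar) *
            vUp hbar (κ * g ^ (2 * N)) δ Y (z + I * hbar))) := by
  obtain ⟨h, hh', hev⟩ :=
    exists_analyticAt_eq_vUp hh.ne' (by positivity) hδ him hi hY hz₀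
  refine ⟨fun z => prefPlus hbar g κ δ z * h z,
    ((differentiable_prefPlus hh (by positivity)).analyticAt z₀).fun_mul hh', ?_⟩
  have hcont : ContinuousAt (fun z => monic δ (z + I * hbar)) z₀ :=
    ((differentiable_monic δ).continuous.comp (by fun_prop)).continuousAt
  have hne : monic δ (z₀ + I * hbar) ≠ 0 := monic_ne_zero_of_abs_im_lt him (by
    rw [add_I_mul_im, hz₀]
    exact (by ring : hbar / 2 = -(hbar / 2) + hbar).le.trans (le_abs_self _))
  filter_upwards [hev, hcont.eventually_ne hne] with z hz hz₁
  refine ⟨fun hzim => by rw [hz.1 hzim], fun hzim => ?_⟩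
  have hϑ : monic δ z ≠ 0 := monic_ne_zero_of_abs_im_lt him (by linarith [neg_le_abs z.im])
  have hc : shiftConst hbar g N ≠ 0 := shiftConst_ne_zero hg
  have hp := monic_mul_prefPlus_add (δ := δ) hh hg hκ z
  rw [hz.2 hzim, eq_div_of_mul_eq hz₁ ((mul_comm _ _).trans hp)]
  field_simp

theorem exists_entire_eq_prefPlus_mul_vUp (hh : 0 < hbar) (hg : 0 < g) (hκ : 0 < κ)
    (hδ : SelfConj δ) (him : ∀ k, |(δ k).im| < hbar / 2)
    (hi : Integrable (logV hbar (κ * g ^ (2 * N)) δ Y))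
    (hY : IsNLIESolution hbar (κ * g ^ (2 * N)) δ Y) :
    ∃ F : ℂ → ℂ, Differentiable ℂ F ∧
      Set.EqOn F (fun z => prefPlus hbar g κ δ z * vUp hbar (κ * g ^ (2 * N)) δ Y z)
        {z | -(hbar / 2) < z.im} ∧
      ∀ z : ℂ, z.im < -(hbar / 2) → F z =
        vUp hbar (κ * g ^ (2 * N)) δ Y z * prefPlus hbar g κ δ z +
          vUp hbar (κ * g ^ (2 * N)) δ Y z * vDownShift hbar (κ * g ^ (2 * N)) δ Y z /
            (shiftConst hbar g N * monic δ z) * F (z + I * hbar) := by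
  have hp : Differentiable ℂ (prefPlus hbar g κ δ) := differentiable_prefPlus hh (by positivity)
  have hϑ : ∀ z : ℂ, z.im < -(hbar / 2) → shiftConst hbar g N * monic δ z ≠ 0 := fun z hz =>
    mul_ne_zero (shiftConst_ne_zero hg)
      (monic_ne_zero_of_abs_im_lt him (by linarith [neg_le_abs z.im]))
  refine exists_entire_solution_of_step hh (c := -(hbar / 2)) ?_ ?_ ?_ fun z₀ hz₀ =>
    exists_analyticAt_eq_prefPlus_mul_vUp hh hg hκ hδ him hi hY hz₀
  · exact fun z hz => ((hp z).fun_mul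
      (differentiableAt_vUp hi (ne_of_gt hz))).differentiableWithinAt
  · exact fun z hz => ((differentiableAt_vUp hi (ne_of_lt hz)).fun_mul
      (hp z)).differentiableWithinAt
  · refine fun z (hz : z.im < -(hbar / 2)) => DifferentiableAt.differentiableWithinAt ?_
    exact ((differentiableAt_vUp hi hz.ne).fun_mul
      (differentiableAt_vDownShift hi (by linarith : z.im < hbar / 2).ne)).fun_div
        ((differentiable_monic δ z).const_mul _) (hϑ z hz)

theorem QPlus_spec (hh : 0 < hbar) (hg : 0 < g) (hκ : 0 < κ)
    (hδ : SelfConj δ) (him : ∀ k, |(δ k).im| < hbar / 2)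
    (hi : Integrable (logV hbar (κ * g ^ (2 * N)) δ Y))
    (hY : IsNLIESolution hbar (κ * g ^ (2 * N)) δ Y) :
    Differentiable ℂ (QPlus hbar g κ δ Y) ∧
      (∀ z : ℂ, -(hbar / 2) < z.im →
        QPlus hbar g κ δ Y z = prefPlus hbar g κ δ z * vUp hbar (κ * g ^ (2 * N)) δ Y z) ∧
      ∀ z : ℂ, z.im < -(hbar / 2) → QPlus hbar g κ δ Y z =
        vUp hbar (κ * g ^ (2 * N)) δ Y z * prefPlus hbar g κ δ z +
          vUp hbar (κ * g ^ (2 * N)) δ Y z * vDownShift hbar (κ * g ^ (2 * N)) δ Y z /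
            (shiftConst hbar g N * monic δ z) * QPlus hbar g κ δ Y (z + I * hbar) := by
  obtain ⟨F, hF, hEq, hrec⟩ := exists_entire_eq_prefPlus_mul_vUp hh hg hκ hδ him hi hY
  have hQ : QPlus hbar g κ δ Y = F := by
    refine entireContinuation_eq (isOpen_lt_im _) ⟨0, by simpa using hh⟩ hF fun z hz => ?_
    exact (hEq hz).trans (by simp only [prefPlus, div_mul_eq_mul_div])
  exact hQ ▸ ⟨hF, fun z hz => hEq hz, hrec⟩

theorem QMinus_eq_conj (hh : 0 < hbar) (hg : 0 < g) (hκ : 0 < κ)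
    (hδ : SelfConj δ) (him : ∀ k, |(δ k).im| < hbar / 2)
    (hi : Integrable (logV hbar (κ * g ^ (2 * N)) δ Y))
    (hY : IsNLIESolution hbar (κ * g ^ (2 * N)) δ Y) :
    QMinus hbar g κ δ Y = fun z =>
      exp (-I * Real.log κ * z) * (starRingEnd ℂ) (QPlus hbar g κ δ Y ((starRingEnd ℂ) z)) := by
  obtain ⟨hd, hEq, -⟩ := QPlus_spec hh hg hκ hδ him hi hY
  refine entireContinuation_eq (isOpen_im_lt _) ⟨0, by simpa using hh⟩ ?_ fun z hz => ?_
  · refine Differentiable.fun_mul (by fun_prop) fun z => ?_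
    have h := (hd ((starRingEnd ℂ) z)).conj_conj
    rwa [conj_conj] at h
  · have hz' : -(hbar / 2) < ((starRingEnd ℂ) z).im := by
      rw [conj_im]
      exact neg_lt_neg hz
    rw [hEq _ hz', map_mul, ← mul_assoc, ← prefMinus_eq_conj hh hg hκ hδ, ← vDownShift_eq_conj,
      prefMinus, div_mul_eq_mul_div]

theorem QMinus_spec (hh : 0 < hbar) (hg : 0 < g) (hκ : 0 < κ)
    (hδ : SelfConj δ) (him : ∀ k, |(δ k).im| < hbar / 2)
    (hi : Integrable (logV hbar (κ * g ^ (2 * N)) δ Y))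
    (hY : IsNLIESolution hbar (κ * g ^ (2 * N)) δ Y) :
    Differentiable ℂ (QMinus hbar g κ δ Y) ∧ ∀ z : ℂ, z.im < hbar / 2 →
        QMinus hbar g κ δ Y z =
          prefMinus hbar g δ z * vDownShift hbar (κ * g ^ (2 * N)) δ Y z := by
  obtain ⟨hd, hEq, -⟩ := QPlus_spec hh hg hκ hδ him hi hY
  rw [QMinus_eq_conj hh hg hκ hδ him hi hY]
  refine ⟨Differentiable.fun_mul (by fun_prop) fun z => ?_, fun z hz => ?_⟩
  · have h := (hd ((starRingEnd ℂ) z)).conj_conj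
    rwa [conj_conj] at h
  · have hz' : -(hbar / 2) < ((starRingEnd ℂ) z).im := by
      rw [conj_im]
      exact neg_lt_neg hz
    simp only
    rw [hEq _ hz', map_mul, ← mul_assoc, ← prefMinus_eq_conj hh hg hκ hδ, ← vDownShift_eq_conj]

end BaxterFunctions

/-! ### The quantum Wronskian and the Baxter polynomial -/

section Baxter

variable {hbar g κ : ℝ} {N : ℕ} {δ τ : Fin N → ℂ} {Y : ℝ → ℝ}

theorem wronskian_eq (hh : 0 < hbar) (hg : 0 < g) (hκ : 0 < κ)
    (hδ : SelfConj δ) (him : ∀ k, |(δ k).im| < hbar / 2)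
    (hi : Integrable (logV hbar (κ * g ^ (2 * N)) δ Y))
    (hY : IsNLIESolution hbar (κ * g ^ (2 * N)) δ Y) :
    wronskian hbar g κ δ Y = fun z =>
      shiftConst hbar g N * monic δ z * prefPlus hbar g κ δ z * prefMinus hbar g δ z := by
  obtain ⟨hP, -, hPrec⟩ := QPlus_spec hh hg hκ hδ him hi hY
  obtain ⟨hM, hMeq⟩ := QMinus_spec hh hg hκ hδ him hi hY
  refine eq_of_eqOn_of_isOpen
    ((hP.fun_mul (hM.fun_comp (by fun_prop))).fun_sub ((hP.fun_comp (by fun_prop)).fun_mul hM))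
    ((((differentiable_monic δ).const_mul _).fun_mul (differentiable_prefPlus hh (by positivity))
      ).fun_mul (differentiable_prefMinus hh hg hδ))
    (isOpen_im_lt (-(hbar / 2))) ⟨-I * hbar, by simp [hh]⟩ fun z (hz : z.im < -(hbar / 2)) => ?_
  have hϑ : monic δ z ≠ 0 := monic_ne_zero_of_abs_im_lt him (by linarith [neg_le_abs z.im])
  have hs : shiftConst hbar g N ≠ 0 := shiftConst_ne_zero hg
  have hz₁ : (z + I * hbar).im < hbar / 2 := by
    rw [add_I_mul_im]
    linarith
  have hud := vUp_mul_vDownShift_add (hbar := hbar) (ρ := κ * g ^ (2 * N)) (δ := δ) (Y := Y) z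
  rw [wronskian, hPrec z hz, hMeq z (by linarith), hMeq _ hz₁, prefMinus_add hh hg hδ]
  field_simp
  linear_combination (shiftConst hbar g N * monic δ z * prefPlus hbar g κ δ z *
    prefMinus hbar g δ z + prefMinus hbar g δ z * vDownShift hbar (κ * g ^ (2 * N)) δ Y z *
      QPlus hbar g κ δ Y (z + I * hbar)) * hud

/-- Elimination of the extreme shifts `P₀` and `M₂` from the relation `ht` defining `t`, by means
of the Wronskians at two neighbouring points. -/
theorem mul_mul_eq_of_wronskian {R : Type*} [CommRing R] [IsDomain R]
    {P₀ P₁ P₂ M₀ M₁ M₂ w s C t : R} (hw : w ≠ 0) (hW : P₁ * M₂ - P₂ * M₁ = w)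
    (hW₀ : s * C * (P₀ * M₁ - P₁ * M₀) = w) (ht : C * (P₀ * M₂ - P₂ * M₀) = t * w) :
    s * t * (P₁ * M₁) = w + P₂ * M₁ + s * C * (P₁ * M₀) := by
  apply mul_right_cancel₀ hw
  linear_combination (-s * (P₁ * M₁)) * ht + P₁ * M₂ * hW₀ + (w + s * C * P₁ * M₀) * hW

theorem transferMatrix_mul_QPlus_mul_QMinus (hh : 0 < hbar) (hg : 0 < g) (hκ : 0 < κ)
    (hδ : SelfConj δ) (him : ∀ k, |(δ k).im| < hbar / 2)
    (hi : Integrable (logV hbar (κ * g ^ (2 * N)) δ Y))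
    (hY : IsNLIESolution hbar (κ * g ^ (2 * N)) δ Y) (ht : IsZerosOfTDelta hbar g κ δ τ Y)
    {z : ℂ} (hz : wronskian hbar g κ δ Y z ≠ 0) :
    shiftConst hbar g N * monic τ z * (QPlus hbar g κ δ Y z * QMinus hbar g κ δ Y z) =
      wronskian hbar g κ δ Y z + QPlus hbar g κ δ Y (z + I * hbar) * QMinus hbar g κ δ Y z +
        shiftConst hbar g N * ((-I) ^ N * (((κ * g ^ N) ^ hbar : ℝ) : ℂ)) *
          (QPlus hbar g κ δ Y z * QMinus hbar g κ δ Y (z - I * hbar)) := by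
  have hback : z - I * hbar + I * hbar = z := sub_add_cancel _ _
  have hW := wronskian_eq hh hg hκ hδ him hi hY
  refine mul_mul_eq_of_wronskian hz rfl ?_ ((div_eq_iff hz).1 (ht z hz))
  have hW₀ := congrFun hW (z - I * hbar)
  have hp := monic_mul_prefPlus_add (δ := δ) hh hg hκ (z - I * hbar)
  have hm := prefMinus_add (δ := δ) hh hg hδ (z - I * hbar)
  rw [wronskian, hback] at hW₀
  rw [hback] at hp hm
  rw [hW₀, hW, neg_I_pow_mul_rpow hg hκ.le]
  dsimp only
  linear_combination (-shiftConst hbar g N * prefMinus hbar g δ z) * hp -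
    (shiftConst hbar g N ^ 2 * (((κ * g ^ (2 * N)) ^ hbar : ℝ) : ℂ) *
      prefPlus hbar g κ δ (z - I * hbar)) * hm

theorem monic_mul_vUp_mul_vDownShift (hh : 0 < hbar) (hg : 0 < g) (hκ : 0 < κ)
    (hδ : SelfConj δ) (him : ∀ k, |(δ k).im| < hbar / 2)
    (hi : Integrable (logV hbar (κ * g ^ (2 * N)) δ Y))
    (hY : IsNLIESolution hbar (κ * g ^ (2 * N)) δ Y) (ht : IsZerosOfTDelta hbar g κ δ τ Y)
    {x : ℝ} (hx : monic δ x ≠ 0) :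
    monic τ x * (vUp hbar (κ * g ^ (2 * N)) δ Y x * vDownShift hbar (κ * g ^ (2 * N)) δ Y x) =
      monic δ x + (((κ * g ^ (2 * N)) ^ hbar : ℝ) : ℂ) *
        (vUp hbar (κ * g ^ (2 * N)) δ Y (x + I * hbar) *
            vDownShift hbar (κ * g ^ (2 * N)) δ Y x / monic δ (x + I * hbar) +
          vUp hbar (κ * g ^ (2 * N)) δ Y x *
            vDownShift hbar (κ * g ^ (2 * N)) δ Y (x - I * hbar) / monic δ (x - I * hbar)) := by
  obtain ⟨-, hP, -⟩ := QPlus_spec hh hg hκ hδ him hi hY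
  obtain ⟨-, hM⟩ := QMinus_spec hh hg hκ hδ him hi hY
  have hs : shiftConst hbar g N ≠ 0 := shiftConst_ne_zero hg
  have hp : prefPlus hbar g κ δ x ≠ 0 := prefPlus_ne_zero hh (by positivity) fun k => by
    linarith [(abs_lt.1 (him k)).2, ofReal_im x]
  have hm : prefMinus hbar g δ x ≠ 0 := prefMinus_ne_zero hh hg hδ fun k => by
    linarith [(abs_lt.1 (him k)).2, ofReal_im x]
  have hW := congrFun (wronskian_eq hh hg hκ hδ him hi hY) x
  have hwx : wronskian hbar g κ δ Y x ≠ 0 :=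
    hW ▸ mul_ne_zero (mul_ne_zero (mul_ne_zero hs hx) hp) hm
  have himUp : ((x : ℂ) + I * hbar).im = hbar := by simp
  have himDown : ((x : ℂ) - I * hbar).im = -hbar := by simp
  have hup : monic δ ((x : ℂ) + I * hbar) ≠ 0 := monic_ne_zero_of_abs_im_lt him (by
    rw [himUp]
    linarith [le_abs_self hbar])
  have hdown : monic δ ((x : ℂ) - I * hbar) ≠ 0 := monic_ne_zero_of_abs_im_lt him (by
    rw [himDown, abs_neg]
    linarith [le_abs_self hbar])
  have hpUp := monic_mul_prefPlus_add (δ := δ) hh hg hκ x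
  have hmDown := prefMinus_add (δ := δ) hh hg hδ (x - I * hbar)
  rw [sub_add_cancel] at hmDown
  have hB := transferMatrix_mul_QPlus_mul_QMinus hh hg hκ hδ him hi hY ht hwx
  rw [hW, hP x (by simpa), hP (x + I * hbar) (by rw [himUp]; linarith), hM x (by simpa),
    hM (x - I * hbar) (by rw [himDown]; linarith), neg_I_pow_mul_rpow hg hκ.le,
    eq_div_of_mul_eq hup ((mul_comm _ _).trans hpUp)] at hB
  field_simp at hB ⊢
  apply mul_left_cancel₀ hm
  linear_combination monic δ (x - I * hbar) * hB - (((κ * g ^ (2 * N)) ^ hbar : ℝ) : ℂ) *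
    vUp hbar (κ * g ^ (2 * N)) δ Y x * vDownShift hbar (κ * g ^ (2 * N)) δ Y (x - I * hbar) *
    monic δ (x + I * hbar) * hmDown

end Baxter

/-! ### Expansions in powers of `1 / x` -/

theorem tendsto_ofReal_inv_atTop : Tendsto (fun x : ℝ => (x : ℂ)⁻¹) atTop (𝓝 0) := by
  simpa using tendsto_ofReal_iff.2 tendsto_inv_atTop_zero

theorem isLittleO_inv_pow_succ (M : ℕ) :
    (fun x : ℝ => x⁻¹ ^ (M + 1)) =o[atTop] fun x : ℝ => x⁻¹ ^ M :=
  (isLittleO_pow_pow M.lt_succ_self).comp_tendsto tendsto_inv_atTop_zero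

theorem eq_zero_of_sum_isLittleO_pow {M : ℕ} {c : ℕ → ℂ}
    (h : (fun x : ℝ => ∑ j ∈ Finset.range M, (x : ℂ)⁻¹ ^ j * c j) =o[atTop]
      fun x : ℝ => x * x⁻¹ ^ M) : ∀ j < M, c j = 0 := by
  induction M generalizing c with
  | zero => simp
  | succ M ih =>
    have hcancel : (fun x : ℝ => x * x⁻¹ ^ (M + 1)) =ᶠ[atTop] fun x => x⁻¹ ^ M := by
      filter_upwards [eventually_ne_atTop 0] with x hx
      rw [pow_succ', mul_inv_cancel_left₀ hx]
    have h' := h.congr' EventuallyEq.rfl hcancel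
    have hzero : Tendsto (fun x : ℝ => ∑ j ∈ Finset.range (M + 1), (x : ℂ)⁻¹ ^ j * c j)
        atTop (𝓝 0) :=
      (isLittleO_one_iff ℝ).1 (h'.trans_isBigO ((tendsto_inv_atTop_zero.pow M).isBigO_one ℝ))
    have hlim : Tendsto (fun x : ℝ => ∑ j ∈ Finset.range (M + 1), (x : ℂ)⁻¹ ^ j * c j)
        atTop (𝓝 (c 0)) := by
      have := tendsto_finsetSum (Finset.range (M + 1)) fun j _ =>
        (tendsto_ofReal_inv_atTop.pow j).mul_const (c j)
      simpa [Finset.sum_range_succ'] using this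
    have hc0 : c 0 = 0 := tendsto_nhds_unique hlim hzero
    have hx : (fun x : ℝ => (x : ℂ)) =O[atTop] fun x : ℝ => x := isBigO_of_le _ (by simp)
    have hshift : (fun x : ℝ => ∑ j ∈ Finset.range M, (x : ℂ)⁻¹ ^ j * c (j + 1)) =o[atTop]
        fun x : ℝ => x * x⁻¹ ^ M := by
      refine (hx.mul_isLittleO h').congr' ?_ EventuallyEq.rfl
      filter_upwards [eventually_ne_atTop 0] with x hx0
      rw [Finset.sum_range_succ', hc0, mul_zero, add_zero, Finset.mul_sum]
      refine Finset.sum_congr rfl fun j _ => ?_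
      rw [pow_succ', mul_assoc, mul_inv_cancel_left₀ (ofReal_ne_zero.2 hx0)]
    intro j hj
    cases j with
    | zero => exact hc0
    | succ j => exact ih hshift j (by lia)

/-- `F` has, at `+∞`, the asymptotic expansion `F x = ∑ j < M, c j * x ^ (-(j + 1)) + o(x ^ (-M))`.
There is no constant term: `F` vanishes at infinity. -/
def HasInvPowExpansion (F : ℝ → ℂ) (c : ℕ → ℂ) (M : ℕ) : Prop :=
  (fun x : ℝ => F x - ∑ j ∈ Finset.range M, (x : ℂ)⁻¹ ^ (j + 1) * c j) =o[atTop]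
    fun x : ℝ => x⁻¹ ^ M

namespace HasInvPowExpansion

variable {F G : ℝ → ℂ} {c d : ℕ → ℂ} {M : ℕ}

theorem add (hF : HasInvPowExpansion F c M) (hG : HasInvPowExpansion G d M) :
    HasInvPowExpansion (fun x => F x + G x) (fun j => c j + d j) M :=
  (IsLittleO.add hF hG).congr_left fun x => by
    simp only [mul_add, Finset.sum_add_distrib]
    ring

theorem sub (hF : HasInvPowExpansion F c M) (hG : HasInvPowExpansion G d M) :
    HasInvPowExpansion (fun x => F x - G x) (fun j => c j - d j) M :=
  (IsLittleO.sub hF hG).congr_left fun x => by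
    simp only [mul_sub, Finset.sum_sub_distrib]
    ring

theorem sum {ι : Type*} {s : Finset ι} {F : ι → ℝ → ℂ} {c : ι → ℕ → ℂ}
    (h : ∀ i ∈ s, HasInvPowExpansion (F i) (c i) M) :
    HasInvPowExpansion (fun x => ∑ i ∈ s, F i x) (fun j => ∑ i ∈ s, c i j) M :=
  (IsLittleO.fun_sum h).congr_left fun x => by
    simp only [Finset.sum_sub_distrib, Finset.mul_sum]
    rw [Finset.sum_comm]

theorem tendsto_zero (h : HasInvPowExpansion F c M) : Tendsto F atTop (𝓝 0) := by
  have hrem := (isLittleO_one_iff ℝ).1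
    (h.trans_isBigO ((tendsto_inv_atTop_zero.pow M).isBigO_one ℝ))
  have hsum := tendsto_finsetSum (Finset.range M) fun j _ =>
    (tendsto_ofReal_inv_atTop.pow (j + 1)).mul_const (c j)
  simpa using hrem.add hsum

theorem eq_zero_of_isBigO (h : HasInvPowExpansion F c M)
    (hF : F =O[atTop] fun x : ℝ => x⁻¹ ^ (M + 1)) : ∀ j < M, c j = 0 := by
  have hsum := (hF.trans_isLittleO (isLittleO_inv_pow_succ M)).sub h
  have hx : (fun x : ℝ => (x : ℂ)) =O[atTop] fun x : ℝ => x := isBigO_of_le _ (by simp)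
  refine eq_zero_of_sum_isLittleO_pow ((hx.mul_isLittleO hsum).congr' ?_ EventuallyEq.rfl)
  filter_upwards [eventually_ne_atTop 0] with x hx0
  rw [sub_sub_cancel, Finset.mul_sum]
  refine Finset.sum_congr rfl fun j _ => ?_
  rw [pow_succ', mul_assoc, mul_inv_cancel_left₀ (ofReal_ne_zero.2 hx0)]

end HasInvPowExpansion

theorem hasInvPowExpansion_log_one_sub (r : ℂ) (M : ℕ) :
    HasInvPowExpansion (fun x => log (1 - r * (x : ℂ)⁻¹))
      (fun j => -(r ^ (j + 1) / (j + 1))) M := by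
  have hz : Tendsto (fun x : ℝ => -r * (x : ℂ)⁻¹) atTop (𝓝 0) := by
    simpa using tendsto_ofReal_inv_atTop.const_mul (-r)
  have hpow : (fun x : ℝ => (-r * (x : ℂ)⁻¹) ^ (M + 1)) =O[atTop] fun x : ℝ => x⁻¹ ^ (M + 1) :=
    ((isBigO_of_le _ (by simp)).const_mul_left (-r)).pow (M + 1)
  refine (((log_sub_logTaylor_isBigO M).comp_tendsto hz).trans hpow).trans_isLittleO
    (isLittleO_inv_pow_succ M) |>.congr_left fun x => ?_
  simp only [Function.comp_apply, logTaylor, Finset.sum_range_succ', pow_zero, Nat.cast_zero,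
    div_zero, add_zero, neg_mul, ← sub_eq_add_neg]
  congr 1
  refine Finset.sum_congr rfl fun j _ => ?_
  have hsign : (-1 : ℂ) ^ (j + 1) * (-1) ^ (j + 1) = 1 := by simp [← mul_pow]
  rw [neg_pow (r * _), mul_pow r, pow_succ (-1 : ℂ) (j + 1)]
  push_cast
  linear_combination (-(r ^ (j + 1) * (x : ℂ)⁻¹ ^ (j + 1) / (j + 1))) * hsign

/-! ### The Cauchy transform at infinity -/

theorem one_div_one_add_abs_mul_le (x μ : ℝ) :
    1 / ((1 + |μ|) * (1 + |x - μ|)) ≤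
      (1 + |x|) ^ (-(1 / 4) : ℝ) *
        ((1 + |μ|) ^ (-(3 / 2) : ℝ) + (1 + |x - μ|) ^ (-(3 / 2) : ℝ)) := by
  have htri : |x| ≤ |μ| + |x - μ| := by simpa using abs_add_le μ (x - μ)
  have hx : 1 + |x| ≤ (1 + |μ|) * (1 + |x - μ|) := by
    nlinarith [mul_nonneg (abs_nonneg μ) (abs_nonneg (x - μ))]
  have hp : 0 < 1 + |μ| := by positivity
  have hq : 0 < 1 + |x - μ| := by positivity
  generalize 1 + |μ| = p at hp hx ⊢
  generalize 1 + |x - μ| = q at hq hx ⊢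
  have hsq {t : ℝ} (ht : 0 < t) : t ^ (-(3 / 2) : ℝ) = (t ^ (-(3 / 4) : ℝ)) ^ 2 := by
    rw [← Real.rpow_mul_natCast ht.le]
    norm_num
  calc 1 / (p * q) = (p * q) ^ (-(1 / 4) : ℝ) * (p ^ (-(3 / 4) : ℝ) * q ^ (-(3 / 4) : ℝ)) := by
        rw [← Real.mul_rpow hp.le hq.le, ← Real.rpow_add (by positivity), one_div,
          ← Real.rpow_neg_one]
        norm_num
    _ ≤ (1 + |x|) ^ (-(1 / 4) : ℝ) * (p ^ (-(3 / 2) : ℝ) + q ^ (-(3 / 2) : ℝ)) := by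
        refine mul_le_mul (Real.rpow_le_rpow_of_nonpos (by positivity) hx (by norm_num)) ?_
          (by positivity) (by positivity)
        rw [hsq hp, hsq hq]
        nlinarith [sq_nonneg (p ^ (-(3 / 4) : ℝ) - q ^ (-(3 / 4) : ℝ)),
          sq_nonneg (p ^ (-(3 / 4) : ℝ)), sq_nonneg (q ^ (-(3 / 4) : ℝ))]

theorem tendsto_integral_zero_of_norm_le {E : Type*} [NormedAddCommGroup E] [NormedSpace ℝ E]
    {F : ℝ → ℝ → E} {C : ℝ} (hF : ∀ x μ, ‖F x μ‖ ≤ C * (1 / ((1 + |μ|) * (1 + |x - μ|)))) :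
    Tendsto (fun x => ∫ μ, F x μ) atTop (𝓝 0) := by
  have hC : 0 ≤ C := by simpa using (norm_nonneg _).trans (hF 0 0)
  have hi : Integrable fun μ : ℝ => (1 + |μ|) ^ (-(3 / 2) : ℝ) :=
    integrable_one_add_norm (E := ℝ) (by simp; norm_num)
  have hbound (x : ℝ) : ‖∫ μ, F x μ‖ ≤ C * ((1 + |x|) ^ (-(1 / 4) : ℝ) *
      (2 * ∫ μ : ℝ, (1 + |μ|) ^ (-(3 / 2) : ℝ))) := by
    have hix : Integrable fun μ : ℝ => (1 + |x - μ|) ^ (-(3 / 2) : ℝ) := hi.comp_sub_left x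
    calc ‖∫ μ, F x μ‖ ≤ ∫ μ : ℝ, C * ((1 + |x|) ^ (-(1 / 4) : ℝ) *
          ((1 + |μ|) ^ (-(3 / 2) : ℝ) + (1 + |x - μ|) ^ (-(3 / 2) : ℝ))) :=
          norm_integral_le_of_norm_le (((hi.add hix).const_mul _).const_mul _)
            (Eventually.of_forall fun μ => (hF x μ).trans
              (mul_le_mul_of_nonneg_left (one_div_one_add_abs_mul_le x μ) hC))
      _ = _ := by
          rw [integral_const_mul, integral_const_mul, integral_add hi hix,
            integral_sub_left_eq_self (fun μ : ℝ => (1 + |μ|) ^ (-(3 / 2) : ℝ)), two_mul]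
  have hlim : Tendsto (fun x : ℝ => (1 + |x|) ^ (-(1 / 4) : ℝ)) atTop (𝓝 0) :=
    (tendsto_rpow_neg_atTop (by norm_num)).comp
      (tendsto_atTop_add_const_left _ _ tendsto_abs_atTop_atTop)
  exact squeeze_zero_norm hbound (by simpa using (hlim.mul_const _).const_mul C)

section CauchyMoment

variable {f : ℝ → ℂ} {C : ℝ} {n j : ℕ}

theorem norm_ofReal_sub_pow_le (s : ℂ) (j : ℕ) (μ : ℝ) :
    ‖((μ : ℂ) - s) ^ j‖ ≤ (1 + ‖s‖) ^ j * (1 + |μ|) ^ j := by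
  rw [norm_pow, ← mul_pow]
  gcongr
  have hsub : ‖(μ : ℂ) - s‖ ≤ |μ| + ‖s‖ := by simpa using norm_sub_le (μ : ℂ) s
  nlinarith [mul_nonneg (norm_nonneg s) (abs_nonneg μ)]

theorem norm_sub_pow_mul_le (hf : ∀ μ, ‖f μ‖ ≤ C / (1 + |μ|) ^ (n + j)) (s : ℂ) (μ : ℝ) :
    ‖((μ : ℂ) - s) ^ j * f μ‖ ≤ (1 + ‖s‖) ^ j * C * (1 / (1 + |μ|) ^ n) := by
  calc ‖((μ : ℂ) - s) ^ j * f μ‖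
      ≤ ((1 + ‖s‖) ^ j * (1 + |μ|) ^ j) * (C / (1 + |μ|) ^ (n + j)) := by
        rw [norm_mul]
        exact mul_le_mul (norm_ofReal_sub_pow_le s j μ) (hf μ) (norm_nonneg _) (by positivity)
    _ = (1 + ‖s‖) ^ j * C * (1 / (1 + |μ|) ^ n) := by
        rw [pow_add]
        field_simp

theorem integrable_sub_pow_mul (hfm : AEStronglyMeasurable f)
    (hf : ∀ μ, ‖f μ‖ ≤ C / (1 + |μ|) ^ n) (s : ℂ) (hj : j + 2 ≤ n) :
    Integrable fun μ : ℝ => ((μ : ℂ) - s) ^ j * f μ := by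
  obtain ⟨m, hm, rfl⟩ : ∃ m, 2 ≤ m ∧ n = m + j := ⟨n - j, by lia, by lia⟩
  exact ((integrable_one_div_one_add_abs_pow hm).const_mul _).mono'
    ((Continuous.aestronglyMeasurable (by fun_prop)).mul hfm)
    (Eventually.of_forall (norm_sub_pow_mul_le hf s))

/-- The normalised moments `∫ (μ - s) ^ j f(μ) dμ / (2 i π)` of the density `f`: these are the
coefficients of the expansion of `cauchyTransform f (x + s)` in powers of `1 / x`. -/
def cauchyMoment (f : ℝ → ℂ) (s : ℂ) (j : ℕ) : ℂ :=
  ∫ μ : ℝ, 1 / (2 * Real.pi * I) * (((μ : ℂ) - s) ^ j * f μ)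

theorem cauchyMoment_sub_cauchyMoment {s t : ℂ}
    (hs : Integrable fun μ : ℝ => ((μ : ℂ) - s) ^ j * f μ)
    (ht : Integrable fun μ : ℝ => ((μ : ℂ) - t) ^ j * f μ) :
    cauchyMoment f s j - cauchyMoment f t j =
      ∫ μ : ℝ, 1 / (2 * Real.pi * I) * ((((μ : ℂ) - s) ^ j - ((μ : ℂ) - t) ^ j) * f μ) := by
  rw [cauchyMoment, cauchyMoment, ← integral_sub (hs.const_mul _) (ht.const_mul _)]
  simp only [← mul_sub, ← sub_mul]

theorem one_div_sub_eq_sum_add {x u : ℂ} (hx : x ≠ 0) (hu : x - u ≠ 0) (M : ℕ) :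
    1 / (x - u) = ∑ j ∈ Finset.range M, x⁻¹ ^ (j + 1) * u ^ j + x⁻¹ ^ M * (u ^ M / (x - u)) := by
  induction M with
  | zero => simp
  | succ M ih =>
    rw [Finset.sum_range_succ, ih, pow_succ x⁻¹]
    generalize x⁻¹ ^ M = y
    field_simp
    ring

theorem cauchyTransform_sub_sum_cauchyMoment {M : ℕ} {s : ℂ} (hf : Integrable f)
    (hm : ∀ j < M, Integrable fun μ : ℝ => ((μ : ℂ) - s) ^ j * f μ) (hs : s.im ≠ 0) {x : ℝ}
    (hx : x ≠ 0) :
    cauchyTransform f (x + s) - ∑ j ∈ Finset.range M, (x : ℂ)⁻¹ ^ (j + 1) * cauchyMoment f s j =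
      (x : ℂ)⁻¹ ^ M *
        ∫ μ : ℝ, 1 / (2 * Real.pi * I) * (((μ : ℂ) - s) ^ M * f μ / (x - (μ - s))) := by
  have him : ((x : ℂ) + s).im ≠ 0 := by simpa using hs
  have hint : ∀ j ∈ Finset.range M, Integrable fun μ : ℝ =>
      (x : ℂ)⁻¹ ^ (j + 1) * (1 / (2 * Real.pi * I) * (((μ : ℂ) - s) ^ j * f μ)) := fun j hj =>
    ((hm j (Finset.mem_range.1 hj)).const_mul _).const_mul _
  simp only [cauchyTransform, cauchyMoment, ← integral_const_mul ((x : ℂ)⁻¹ ^ _)]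
  rw [← integral_finsetSum _ hint,
    ← integral_sub (integrable_cauchy_integrand hf him) (integrable_finsetSum _ hint)]
  refine integral_congr_ae (Eventually.of_forall fun μ => ?_)
  have hshift : (x : ℂ) + s - μ = x - (μ - s) := by ring
  have hgeom := one_div_sub_eq_sum_add (ofReal_ne_zero.2 hx)
    (hshift ▸ sub_ofReal_ne_zero him μ) M
  have hsum : ∑ j ∈ Finset.range M,
      (x : ℂ)⁻¹ ^ (j + 1) * (1 / (2 * Real.pi * I) * (((μ : ℂ) - s) ^ j * f μ)) =
        1 / (2 * Real.pi * I) * f μ * ∑ j ∈ Finset.range M, (x : ℂ)⁻¹ ^ (j + 1) * (μ - s) ^ j := by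
    rw [Finset.mul_sum]
    exact Finset.sum_congr rfl fun j _ => by ring
  dsimp only
  rw [hsum, hshift]
  linear_combination (1 / (2 * Real.pi * I) * f μ) * hgeom

theorem hasInvPowExpansion_cauchyTransform {M : ℕ} (hM : M ≠ 0) (hfm : AEStronglyMeasurable f)
    (hf : ∀ μ, ‖f μ‖ ≤ C / (1 + |μ|) ^ (M + 1)) {s : ℂ} (hs : s.im ≠ 0) :
    HasInvPowExpansion (fun x => cauchyTransform f (x + s)) (cauchyMoment f s) M := by
  have hm : ∀ j < M, Integrable fun μ : ℝ => ((μ : ℂ) - s) ^ j * f μ := fun j hj =>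
    integrable_sub_pow_mul hfm hf s (by lia)
  have hfi : Integrable f := by simpa using hm 0 (Nat.pos_of_ne_zero hM)
  obtain ⟨c, hc, hcμ⟩ := exists_le_norm_ofReal_sub (u := -s) (by simpa using hs)
  have hlim : Tendsto (fun x : ℝ =>
      ∫ μ : ℝ, 1 / (2 * Real.pi * I) * (((μ : ℂ) - s) ^ M * f μ / (x - (μ - s)))) atTop (𝓝 0) := by
    refine tendsto_integral_zero_of_norm_le (C := 1 / (2 * Real.pi) * ((1 + ‖s‖) ^ M * C / c))
      fun x μ => ?_
    have hnum := norm_sub_pow_mul_le (n := 1) (by simpa only [add_comm] using hf) s μ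
    have hden : c * (1 + |x - μ|) ≤ ‖(x : ℂ) - (μ - s)‖ := by
      simpa only [ofReal_sub, sub_neg_eq_add, sub_add] using hcμ (x - μ)
    calc ‖1 / (2 * Real.pi * I) * (((μ : ℂ) - s) ^ M * f μ / (x - (μ - s)))‖
        = 1 / (2 * Real.pi) * (‖((μ : ℂ) - s) ^ M * f μ‖ / ‖(x : ℂ) - (μ - s)‖) := by
          rw [norm_mul, norm_one_div_two_pi_I, norm_div]
      _ ≤ 1 / (2 * Real.pi) *
            ((1 + ‖s‖) ^ M * C * (1 / (1 + |μ|) ^ 1) / (c * (1 + |x - μ|))) := by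
          gcongr
          exact (norm_nonneg _).trans hnum
      _ = _ := by
          field_simp
  have hpow : (fun x : ℝ => (x : ℂ)⁻¹ ^ M) =O[atTop] fun x : ℝ => x⁻¹ ^ M :=
    isBigO_of_le _ (by simp)
  refine (hpow.mul_isLittleO ((isLittleO_one_iff ℝ).2 hlim)).congr' ?_ (by simp)
  filter_upwards [eventually_ne_atTop 0] with x hx
  exact (cauchyTransform_sub_sum_cauchyMoment hfi hm hs hx).symm

end CauchyMoment

/-! ### Comparison of the expansions of `τ` and `δ` -/

section MonicAsymptotics

variable {N : ℕ}

theorem monic_div_pow (r : Fin N → ℂ) {z : ℂ} (hz : z ≠ 0) :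
    monic r z / z ^ N = ∏ k, (1 - r k * z⁻¹) := by
  rw [monic, ← Fin.prod_const N z, ← Finset.prod_div_distrib]
  exact Finset.prod_congr rfl fun k _ => by rw [sub_div, div_self hz, div_eq_mul_inv (r k)]

theorem monic_add (r : Fin N → ℂ) (z s : ℂ) : monic r (z + s) = monic (fun k => r k - s) z :=
  Finset.prod_congr rfl fun _ _ => by ring

theorem tendsto_one_sub_mul_inv (r : ℂ) :
    Tendsto (fun x : ℝ => 1 - r * (x : ℂ)⁻¹) atTop (𝓝 1) := by
  simpa using (tendsto_ofReal_inv_atTop.const_mul r).const_sub 1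

theorem inv_monic_isBigO (r : Fin N → ℂ) :
    (fun x : ℝ => (monic r x)⁻¹) =O[atTop] fun x : ℝ => x⁻¹ ^ N := by
  have hprod : Tendsto (fun x : ℝ => ∏ k, (1 - r k * (x : ℂ)⁻¹)) atTop (𝓝 1) := by
    simpa using tendsto_finsetProd Finset.univ fun k _ => tendsto_one_sub_mul_inv (r k)
  have hpow : (fun x : ℝ => (x : ℂ)⁻¹ ^ N) =O[atTop] fun x : ℝ => x⁻¹ ^ N :=
    isBigO_of_le _ (by simp)
  refine (((hprod.inv₀ one_ne_zero).isBigO_one ℝ).mul hpow).congr' ?_ (by simp)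
  filter_upwards [eventually_ne_atTop 0] with x hx
  have hxc : (x : ℂ) ≠ 0 := ofReal_ne_zero.2 hx
  rw [← monic_div_pow r hxc, inv_div, inv_pow]
  field_simp

theorem eventually_exp_sum_log_one_sub (r : Fin N → ℂ) :
    ∀ᶠ x : ℝ in atTop, exp (∑ k, log (1 - r k * (x : ℂ)⁻¹)) = monic r x / (x : ℂ) ^ N := by
  filter_upwards [eventually_all.2 fun k => (tendsto_one_sub_mul_inv (r k)).eventually_ne
    one_ne_zero, eventually_ne_atTop 0] with x hx hx0
  rw [monic_div_pow r (ofReal_ne_zero.2 hx0), exp_sum]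
  exact Finset.prod_congr rfl fun k _ => exp_log (hx k)

theorem eventually_monic_ne_zero (r : Fin N → ℂ) : ∀ᶠ x : ℝ in atTop, monic r x ≠ 0 := by
  filter_upwards [eventually_exp_sum_log_one_sub r] with x hx h0
  exact exp_ne_zero _ (by rw [hx, h0, zero_div])

end MonicAsymptotics

theorem isBigO_exp_sub_one {α : Type*} {l : Filter α} {E : α → ℂ} (hE : Tendsto E l (𝓝 0)) :
    E =O[l] fun x => exp (E x) - 1 := by
  have h := ((hasDerivAt_exp 0).isTheta_sub (exp_ne_zero 0)).symm.isBigO.comp_tendsto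
    (hE.prodMk (tendsto_pure.2 (Eventually.of_forall fun _ => rfl)))
  simpa [Function.comp_def] using h

section PowerSums

variable {hbar g κ ρ : ℝ} {N : ℕ} {δ τ : Fin N → ℂ} {Y : ℝ → ℝ}

theorem hasInvPowExpansion_cauchyLogV (hρ : 0 ≤ ρ) (him : ∀ k, |(δ k).im| < hbar / 2)
    (hY : IsNLIESolution hbar ρ δ Y) {M : ℕ} (hM : M ≠ 0) (hMN : 2 * N = M + 1) {s : ℂ}
    (hs : s.im ≠ 0) :
    HasInvPowExpansion (fun x => cauchyLogV hbar ρ δ Y (x + s))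
      (cauchyMoment (logV hbar ρ δ Y) s) M := by
  obtain ⟨C, hC⟩ := exists_norm_logV_le hρ him hY
  exact hasInvPowExpansion_cauchyTransform hM (continuous_logV hρ him hY).aestronglyMeasurable
    (hMN ▸ hC) hs

theorem tendsto_vUp (hρ : 0 ≤ ρ) (hN : N ≠ 0) (him : ∀ k, |(δ k).im| < hbar / 2)
    (hY : IsNLIESolution hbar ρ δ Y) {s : ℂ} (hs : s.im + hbar / 2 ≠ 0) :
    Tendsto (fun x : ℝ => vUp hbar ρ δ Y (x + s)) atTop (𝓝 1) := by
  have h := (hasInvPowExpansion_cauchyLogV hρ him hY (M := 2 * N - 1) (by lia) (by lia)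
    (s := s + I * hbar / 2) (by simpa using hs)).tendsto_zero
  simpa [vUp_eq, add_assoc, Function.comp_def] using
    (continuous_exp.tendsto 0).comp (by simpa using h.neg)

theorem tendsto_vDownShift (hρ : 0 ≤ ρ) (hN : N ≠ 0) (him : ∀ k, |(δ k).im| < hbar / 2)
    (hY : IsNLIESolution hbar ρ δ Y) {s : ℂ} (hs : s.im - hbar / 2 ≠ 0) :
    Tendsto (fun x : ℝ => vDownShift hbar ρ δ Y (x + s)) atTop (𝓝 1) := by
  have h := (hasInvPowExpansion_cauchyLogV hρ him hY (M := 2 * N - 1) (by lia) (by lia)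
    (s := s - I * hbar / 2) (by simpa using hs)).tendsto_zero
  simpa [vDownShift_eq, add_sub_assoc, Function.comp_def] using (continuous_exp.tendsto 0).comp h

theorem monic_mul_div_monic_sub_one_isBigO (hh : 0 < hbar) (hg : 0 < g) (hκ : 0 < κ) (hN : N ≠ 0)
    (hδ : SelfConj δ) (him : ∀ k, |(δ k).im| < hbar / 2)
    (hY : IsNLIESolution hbar (κ * g ^ (2 * N)) δ Y) (ht : IsZerosOfTDelta hbar g κ δ τ Y) :
    (fun x : ℝ => monic τ x * (vUp hbar (κ * g ^ (2 * N)) δ Y x *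
      vDownShift hbar (κ * g ^ (2 * N)) δ Y x) / monic δ x - 1)
      =O[atTop] fun x : ℝ => x⁻¹ ^ (2 * N) := by
  have hρ : 0 ≤ κ * g ^ (2 * N) := by positivity
  have hi := integrable_logV hN hρ him hY
  have hB := fun x : ℝ => monic_mul_vUp_mul_vDownShift (x := x) hh hg hκ hδ him hi hY ht
  generalize κ * g ^ (2 * N) = ρ at *
  have hu := (tendsto_vUp hρ hN him hY (s := 0) (by simp [hh.ne'])).isBigO_one ℝ
  have hd := (tendsto_vDownShift hρ hN him hY (s := 0) (by simp [hh.ne'])).isBigO_one ℝ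
  have huUp := (tendsto_vUp hρ hN him hY (s := I * hbar) (by simp; linarith)).isBigO_one ℝ
  have hdDown := (tendsto_vDownShift hρ hN him hY (s := -(I * hbar))
    (by simp; linarith)).isBigO_one ℝ
  have hinv (s : ℂ) : (fun x : ℝ => (monic δ (x + s))⁻¹) =O[atTop] fun x : ℝ => x⁻¹ ^ N := by
    simpa only [monic_add] using inv_monic_isBigO fun k => δ k - s
  simp only [add_zero, ← sub_eq_add_neg] at hu hd hdDown
  have hO := ((((huUp.mul hd).mul (hinv (I * hbar))).add
    ((hu.mul hdDown).mul (hinv (-(I * hbar))))).mul (inv_monic_isBigO δ)).const_mul_left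
      ((ρ ^ hbar : ℝ) : ℂ)
  refine hO.congr' ?_ (Eventually.of_forall fun x => by ring)
  filter_upwards [eventually_monic_ne_zero δ] with x hx
  rw [hB x hx, add_div, div_self hx, ← sub_eq_add_neg]
  ring

theorem eventually_exp_eq_monic_mul_div_monic (hbar ρ : ℝ) (δ τ : Fin N → ℂ) (Y : ℝ → ℝ) :
    ∀ᶠ x : ℝ in atTop,
      exp (∑ k, log (1 - τ k * (x : ℂ)⁻¹) - ∑ k, log (1 - δ k * (x : ℂ)⁻¹) -
          cauchyLogV hbar ρ δ Y (x + I * hbar / 2) + cauchyLogV hbar ρ δ Y (x + -(I * hbar / 2))) =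
        monic τ x * (vUp hbar ρ δ Y x * vDownShift hbar ρ δ Y x) / monic δ x := by
  filter_upwards [eventually_exp_sum_log_one_sub τ, eventually_exp_sum_log_one_sub δ,
    eventually_ne_atTop 0] with x hτ hδ hx0
  have hxc : (x : ℂ) ^ N ≠ 0 := pow_ne_zero _ (ofReal_ne_zero.2 hx0)
  rw [exp_add, exp_sub, exp_sub, hτ, hδ, vUp_eq, vDownShift_eq, exp_neg, ← sub_eq_add_neg]
  field_simp

theorem sum_pow_div_eq (hh : 0 < hbar) (hg : 0 < g) (hκ : 0 < κ)
    (hδ : SelfConj δ) (him : ∀ k, |(δ k).im| < hbar / 2)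
    (hY : IsNLIESolution hbar (κ * g ^ (2 * N)) δ Y) (ht : IsZerosOfTDelta hbar g κ δ τ Y)
    {j : ℕ} (hj : j + 2 ≤ 2 * N) :
    (∑ p, τ p ^ (j + 1)) / (j + 1) = (∑ p, δ p ^ (j + 1)) / (j + 1) +
      (cauchyMoment (logV hbar (κ * g ^ (2 * N)) δ Y) (-(I * hbar / 2)) j -
        cauchyMoment (logV hbar (κ * g ^ (2 * N)) δ Y) (I * hbar / 2) j) := by
  obtain ⟨M, hM⟩ : ∃ M, 2 * N = M + 1 := ⟨2 * N - 1, by lia⟩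
  have hρ : 0 ≤ κ * g ^ (2 * N) := by positivity
  have hratio := monic_mul_div_monic_sub_one_isBigO hh hg hκ (by lia) hδ him hY ht
  have hT {s : ℂ} := hasInvPowExpansion_cauchyLogV (s := s) hρ him hY (by lia) hM
  have hlog (r : Fin N → ℂ) :=
    HasInvPowExpansion.sum fun k (_ : k ∈ Finset.univ) => hasInvPowExpansion_log_one_sub (r k) M
  generalize κ * g ^ (2 * N) = ρ at *
  have hE := (((hlog τ).sub (hlog δ)).sub (hT (s := I * hbar / 2) (by simp [hh.ne']))).add
    (hT (s := -(I * hbar / 2)) (by simp [hh.ne']))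
  have hO := (isBigO_exp_sub_one hE.tendsto_zero).trans (hratio.congr'
    ((eventually_exp_eq_monic_mul_div_monic hbar ρ δ τ Y).mono fun x hx => by simp only [hx])
    EventuallyEq.rfl)
  have hcoeff := hE.eq_zero_of_isBigO (hM ▸ hO) j (by lia)
  simp only [Finset.sum_neg_distrib, ← Finset.sum_div] at hcoeff
  linear_combination -hcoeff

theorem integrable_sub_pow_mul_logV (hρ : 0 ≤ ρ) (him : ∀ k, |(δ k).im| < hbar / 2)
    (hY : IsNLIESolution hbar ρ δ Y) (s : ℂ) {j : ℕ} (hj : j + 2 ≤ 2 * N) :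
    Integrable fun μ : ℝ => ((μ : ℂ) - s) ^ j * logV hbar ρ δ Y μ := by
  obtain ⟨C, hC⟩ := exists_norm_logV_le hρ him hY
  exact integrable_sub_pow_mul (continuous_logV hρ him hY).aestronglyMeasurable hC s hj

end PowerSums

end TodaTBA

end

theorem mainTheorem4_general (N : ℕ) (hbar g κ : ℝ) (hhbar : 0 < hbar) (hg : 0 < g) (hκ : 0 < κ)
    (τ δ : Fin N → ℂ) (Y : ℝ → ℝ)
    (hδ : TodaTBA.SelfConj δ)
    (him : ∀ j, |(δ j).im| < hbar / 2)
    (hY : TodaTBA.IsNLIESolution hbar (κ * g ^ (2 * N)) δ Y)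
    (ht : TodaTBA.IsZerosOfTDelta hbar g κ δ τ Y)
    (k : ℕ) (hk : 1 ≤ k) (hkN : k ≤ 2 * N - 1) :
    MeasureTheory.Integrable (fun μ : ℝ =>
        (((μ : ℂ) + Complex.I * hbar / 2) ^ (k - 1) - ((μ : ℂ) - Complex.I * hbar / 2) ^ (k - 1)) *
          (Real.log (TodaTBA.V hbar (κ * g ^ (2 * N)) δ Y μ) : ℂ)) ∧
      ∑ p, τ p ^ k = ∑ p, δ p ^ k +
        k * ∫ μ : ℝ, 1 / (2 * Real.pi * Complex.I) *
          ((((μ : ℂ) + Complex.I * hbar / 2) ^ (k - 1) -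
              ((μ : ℂ) - Complex.I * hbar / 2) ^ (k - 1)) *
            (Real.log (TodaTBA.V hbar (κ * g ^ (2 * N)) δ Y μ) : ℂ)) := by
  obtain ⟨j, rfl⟩ : ∃ j, k = j + 1 := ⟨k - 1, by lia⟩
  have hj : j + 2 ≤ 2 * N := by lia
  have hρ : 0 ≤ κ * g ^ (2 * N) := by positivity
  have hup := TodaTBA.integrable_sub_pow_mul_logV hρ him hY (-(I * hbar / 2)) hj
  have hdown := TodaTBA.integrable_sub_pow_mul_logV hρ him hY (I * hbar / 2) hj
  have hsum := TodaTBA.sum_pow_div_eq hhbar hg hκ hδ him hY ht hj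
  rw [TodaTBA.cauchyMoment_sub_cauchyMoment hup hdown] at hsum
  have hint := hup.sub hdown
  simp only [sub_neg_eq_add, TodaTBA.logV] at hsum hint
  refine ⟨hint.congr (Eventually.of_forall fun μ => (sub_mul _ _ _).symm), ?_⟩
  have hj1 : (j : ℂ) + 1 ≠ 0 := by exact_mod_cast j.succ_ne_zero
  rw [div_add' _ _ _ hj1, div_left_inj' hj1, mul_comm _ ((j : ℂ) + 1)] at hsum
  rw [Nat.add_sub_cancel, Nat.cast_add_one, hsum]

theorem mainTheorem4 (N : ℕ) (hbar g κ : ℝ) (hhbar : 0 < hbar) (hg : 0 < g) (hκ : 0 < κ)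
    (τ δ : Fin N → ℂ) (Y : ℝ → ℝ)
    (hδ : TodaTBA.SelfConj δ)
    (hHill : TodaTBA.IsHillZeros hbar (κ * g ^ (2 * N)) τ δ)
    (hY : TodaTBA.IsNLIESolution hbar (κ * g ^ (2 * N)) δ Y)
    (ht : TodaTBA.IsZerosOfTDelta hbar g κ δ τ Y)
    (hτ : ∀ a, |(τ a).im| < hbar / 2)
    (k : ℕ) (hk : 1 ≤ k) (hkN : k ≤ 2 * N - 1) :
    MeasureTheory.Integrable (fun μ : ℝ =>
        (((μ : ℂ) + Complex.I * hbar / 2) ^ (k - 1) - ((μ : ℂ) - Complex.I * hbar / 2) ^ (k - 1)) *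
          (Real.log (TodaTBA.V hbar (κ * g ^ (2 * N)) δ Y μ) : ℂ)) ∧
      ∑ p, τ p ^ k = ∑ p, δ p ^ k +
        k * ∫ μ : ℝ, 1 / (2 * Real.pi * Complex.I) *
          ((((μ : ℂ) + Complex.I * hbar / 2) ^ (k - 1) -
              ((μ : ℂ) - Complex.I * hbar / 2) ^ (k - 1)) *
            (Real.log (TodaTBA.V hbar (κ * g ^ (2 * N)) δ Y μ) : ℂ)) :=
  mainTheorem4_general N hbar g κ hhbar hg hκ τ δ Y hδ hHill.1 hY ht k hk hkN
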